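/- Let $N,m\ge 1$ be integers and $1<p<\infty$. Let $K\subset\mathbb{R}^N$ be a bounded convex set, symmetric ($K=-K$), containing the origin and with nonempty interior, and let $\|x\|_K=\inf\{\lambda>0 : x/\lambda\in K\}$ be the associated norm. Let $(\rho_\varepsilon)_{\varepsilon>0}$ be a family of functions $\rho_\varepsilon:[0,\infty)\to[0,\infty)$ such that $$\int_0^\infty r^{N-1}\rho_\varepsilon(r)\,dr=1\ \text{ for all }\varepsilon>0\qquad\text{and}\qquad \lim_{\varepsilon\to0^+}\int_\delta^\infty r^{N-1}\rho_\varepsilon(r)\,dr=0\ \text{ for all }\delta>0 .$$ For $f:\mathbb{R}^N\to\mathbb{R}$ in the Sobolev space $W^{m,p}(\mathbb{R}^N)$ put $$R^mf(x,y)=\sum_{j=0}^m(-1)^j\binom mj f\Big(\frac{m-j}{m}x+\frac jm y\Big),\qquad D^mf(x)(\sigma,\dots,\sigma)=\sum_{1\le i_1,\dots,i_m\le N}\sigma_{i_1}\cdots\sigma_{i_m}\frac{\partial^m f}{\partial x_{i_1}\cdots\partial x_{i_m}}(x),$$ where the partial derivatives are weak derivatives. Then, for every $f\in W^{m,p}(\mathbb{R}^N)$,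 all the integrals below are finite and $$\lim_{\varepsilon\to0^+}\int_{\mathbb{R}^N}\int_{\mathbb{R}^N}\frac{|R^mf(x,y)|^p}{\|x-y\|_K^{mp}}\,\rho_\varepsilon(\|x-y\|_K)\,dx\,dy=\frac{N+mp}{m^{mp}}\int_{\mathbb{R}^N}\int_K|D^mf(x)(y,\dots,y)|^p\,dy\,dx .$$ -/

import Mathlib

open MeasureTheory Filter Topology Set

noncomputable section

namespace HighOrderBBM

/-- The Euclidean space `ℝ^N`. -/
abbrev E (N : ℕ) : Type := EuclideanSpace ℝ (Fin N)

/-- The classical partial derivative `∂^k φ / ∂x_{i₁} … ∂x_{i_k}` at `x` of a smooth function `φ`,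
for a tuple of indices `I = (i₁, …, i_k)`. -/
def partialDeriv {N k : ℕ} (I : Fin k → Fin N) (φ : E N → ℝ) (x : E N) : ℝ :=
  iteratedFDeriv ℝ k φ x (fun j => EuclideanSpace.single (I j) (1 : ℝ))

/-- `g` is a weak partial derivative `∂^k f / ∂x_{i₁} … ∂x_{i_k}` of `f` on `ℝ^N`:
`∫ f ∂^k φ = (-1)^k ∫ g φ` for every test function `φ ∈ C_c^∞(ℝ^N)`. -/
structure HasWeakPartialDeriv {N k : ℕ} (I : Fin k → Fin N) (f g : E N → ℝ) : Prop where
  locallyIntegrable : LocallyIntegrable f volume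
  locallyIntegrable_deriv : LocallyIntegrable g volume
  integral_eq : ∀ φ : E N → ℝ, ContDiff ℝ ((⊤ : ℕ∞) : WithTop ℕ∞) φ → HasCompactSupport φ →
    ∫ x, f x * partialDeriv I φ x = (-1 : ℝ) ^ k * ∫ x, g x * φ x

/-- The Sobolev space `W^{m,p}(ℝ^N)`: `f ∈ L^p`, and all weak partial derivatives of `f` of order
at most `m` exist and belong to `L^p`. -/
def MemSobolev {N : ℕ} (m : ℕ) (p : ℝ) (f : E N → ℝ) : Prop :=
  MemLp f (ENNReal.ofReal p) volume ∧
    ∀ k ≤ m, ∀ I : Fin k → Fin N, ∃ g : E N → ℝ,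
      MemLp g (ENNReal.ofReal p) volume ∧ HasWeakPartialDeriv I f g

open Classical in
/-- A representative of the weak partial derivative `∂^k f / ∂x_{i₁} … ∂x_{i_k}`, which is unique
up to equality almost everywhere (and `0` if `f` has no such weak derivative). -/
def weakPartialDeriv {N k : ℕ} (I : Fin k → Fin N) (f : E N → ℝ) : E N → ℝ :=
  if h : ∃ g, HasWeakPartialDeriv I f g then h.choose else 0

/-- `D^k f(x)(σ, …, σ) = ∑_{i₁, …, i_k} σ_{i₁} ⋯ σ_{i_k} ∂^k f / ∂x_{i₁} … ∂x_{i_k} (x)`. -/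
def weakDiff {N : ℕ} (k : ℕ) (f : E N → ℝ) (x σ : E N) : ℝ :=
  ∑ I : Fin k → Fin N, (∏ j, σ (I j)) * weakPartialDeriv I f x

/-- `R^m f(x, y) = ∑_{j=0}^m (-1)^j (m choose j) f(((m - j)/m) x + (j/m) y)`. -/
def finiteDiff {N : ℕ} (m : ℕ) (f : E N → ℝ) (x y : E N) : ℝ :=
  ∑ j ∈ Finset.range (m + 1), (-1 : ℝ) ^ j * (m.choose j : ℝ) *
    f ((((m : ℝ) - (j : ℝ)) / (m : ℝ)) • x + ((j : ℝ) / (m : ℝ)) • y)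

/-- The integrand `|R^m f(x,y)|^p ‖x - y‖_K^{-mp} ρ(‖x - y‖_K)`, where
`‖z‖_K = inf {r > 0 | z ∈ r K}` is the gauge of `K`. -/
def bbmIntegrand {N : ℕ} (K : Set (E N)) (m : ℕ) (p : ℝ) (ρ : ℝ → ℝ) (f : E N → ℝ)
    (x y : E N) : ℝ :=
  |finiteDiff m f x y| ^ p / gauge K (x - y) ^ ((m : ℝ) * p) * ρ (gauge K (x - y))

end HighOrderBBM

end

open MeasureTheory Filter Topology Set
open scoped ENNReal fwdDiff

/-! Write `y = x + h` and `s = h/m`. Up to sign, `R^m f(x, x+h)` is the iterated difference `Δ_s^m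
f(x)`, so the energy is the integral over `h` of `A(h) ‖h‖_K^{-mp} ρ(‖h‖_K)` with `A(h) = ‖Δ_s^m
f‖_p^p`.

Peano's formula writes `Δ_s^m f(x)` as the average of `D^m f(x + ts)(s, …, s)` over a probability
measure `ν` on `[0, m]` (`exists_peano_measure`); duality with test functions extends it to Sobolev
functions (`fwdDiff_iter_ae_eq`). By Jensen and the continuity of translations in `L^p`, `Δ_s^m f`
differs from `D^m f(·)(s, …, s)` by `o(‖s‖^m)` in `L^p`. Hence `A(h) = m^{-mp} W(h) + o(‖h‖^{mp})`,
where `W(h) = ∫ |D^m f(x)(h, …, h)|^p dx` is homogeneous of degree `mp`.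

Polar coordinates adapted to the gauge (`lintegral_mul_comp_homogeneous`) show that the energy with
`W` in place of `A` is exactly `(N + mp) ∫_K W` for every kernel of mass one. The error is small
near the origin; away from it, the bound `A, W ≤ B ‖h‖^{mp}` leaves a multiple of the tail mass of
`ρ`, which tends to zero (`MemSobolev.exists_abs_energy_sub_le`). -/

namespace HighOrderBBM

/-! ### Peano's formula for finite differences of smooth functions. -/

section Spline

variable {V : Type*} [NormedAddCommGroup V] [NormedSpace ℝ V]

theorem hasDerivAt_iteratedFDeriv_line {φ : V → ℝ} (hφ : ContDiff ℝ ((⊤ : ℕ∞) : WithTop ℕ∞) φ)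
    (n : ℕ) (y s : V) (τ : ℝ) :
    HasDerivAt (fun τ : ℝ => iteratedFDeriv ℝ n φ (y + τ • s) (fun _ => s))
      (iteratedFDeriv ℝ (n + 1) φ (y + τ • s) (fun _ => s)) τ := by
  have hd : DifferentiableAt ℝ (iteratedFDeriv ℝ n φ) (y + τ • s) :=
    (hφ.differentiable_iteratedFDeriv (m := n) (by exact_mod_cast ENat.natCast_lt_top n)).differentiableAt
  have h1 : HasDerivAt (fun τ : ℝ => y + τ • s) s τ := by
    simpa using ((hasDerivAt_id τ).smul_const s).const_add y
  have h2 := hd.hasFDerivAt.comp_hasDerivAt τ h1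
  have h3 := ((ContinuousMultilinearMap.apply ℝ (fun _ : Fin n => V) ℝ
    (fun _ => s)).hasFDerivAt).comp_hasDerivAt τ h2
  simpa [iteratedFDeriv_succ_apply_left, Function.comp_def, Fin.tail_def] using h3

theorem continuous_iteratedFDeriv_diag {φ : V → ℝ}
    (hφ : ContDiff ℝ ((⊤ : ℕ∞) : WithTop ℕ∞) φ) (n : ℕ) (s : V) :
    Continuous (fun x => iteratedFDeriv ℝ n φ x (fun _ => s)) := by
  have h := hφ.continuous_iteratedFDeriv (m := n) (by exact_mod_cast le_top)
  exact (ContinuousMultilinearMap.apply ℝ (fun _ : Fin n => V) ℝ (fun _ => s)).continuous.comp h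

/-- The fundamental theorem of calculus on the segment from `y` to `y + s`: each difference becomes
one more derivative, averaged over the uniform law on `[0, 1]`. -/
theorem iteratedFDeriv_fwdDiff {φ : V → ℝ} (hφ : ContDiff ℝ ((⊤ : ℕ∞) : WithTop ℕ∞) φ)
    (n : ℕ) (y s : V) :
    iteratedFDeriv ℝ n (Δ_[s] φ) y (fun _ => s) =
      ∫ τ in Icc (0 : ℝ) 1, iteratedFDeriv ℝ (n + 1) φ (y + τ • s) (fun _ => s) := by
  have h1 : Δ_[s] φ = (fun x => φ (x + s)) - φ := by ext; simp [fwdDiff]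
  have hc : ContDiff ℝ ((⊤ : ℕ∞) : WithTop ℕ∞) (fun x => φ (x + s)) :=
    hφ.comp (contDiff_id.add contDiff_const)
  rw [h1, iteratedFDeriv_sub_apply (hc.contDiffAt.of_le (by exact_mod_cast le_top))
    (hφ.contDiffAt.of_le (by exact_mod_cast le_top)), iteratedFDeriv_comp_add_right,
    integral_Icc_eq_integral_Ioc, ← intervalIntegral.integral_of_le zero_le_one,
    intervalIntegral.integral_eq_sub_of_hasDerivAt
      (fun τ _ => hasDerivAt_iteratedFDeriv_line hφ n y s τ)]
  · simp
  · exact Continuous.intervalIntegrable ((continuous_iteratedFDeriv_diag hφ (n + 1) s).comp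
      (by fun_prop)) _ _

/-- The Peano kernel of the `m`-th finite difference (a cardinal B-spline), as a measure. -/
theorem exists_peano_measure (m : ℕ) : ∃ ν : Measure ℝ, IsProbabilityMeasure ν ∧
    (∀ᵐ t ∂ν, t ∈ Icc (0 : ℝ) m) ∧
    ∀ (V : Type) [NormedAddCommGroup V] [NormedSpace ℝ V] (φ : V → ℝ),
      ContDiff ℝ ((⊤ : ℕ∞) : WithTop ℕ∞) φ → ∀ s x : V,
      ((fwdDiff s)^[m] φ) x = ∫ t, iteratedFDeriv ℝ m φ (x + t • s) (fun _ => s) ∂ν := by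
  induction m with
  | zero =>
    refine ⟨Measure.dirac 0, inferInstance, ?_, ?_⟩
    · refine (ae_dirac_iff (p := fun t => t ∈ Icc (0 : ℝ) (0 : ℕ)) measurableSet_Icc).2 ?_
      simp
    · intro V _ _ φ hφ s x
      simp
  | succ m ih =>
    obtain ⟨ν, hν, hs, h⟩ := ih
    let lam : Measure ℝ := volume.restrict (Icc (0 : ℝ) 1)
    have hlam : IsProbabilityMeasure lam := ⟨by simp [lam]⟩
    have hm : Measurable (fun q : ℝ × ℝ => q.1 + q.2) := by fun_prop
    have hae : ∀ᵐ q ∂(ν.prod lam), q.1 + q.2 ∈ Icc (0 : ℝ) (m + 1 : ℕ) := by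
      have h1 : ∀ᵐ q ∂(ν.prod lam), q.1 ∈ Icc (0 : ℝ) m :=
        Measure.quasiMeasurePreserving_fst.ae hs
      have h2 : ∀ᵐ q ∂(ν.prod lam), q.2 ∈ Icc (0 : ℝ) 1 :=
        Measure.quasiMeasurePreserving_snd.ae (ae_restrict_mem measurableSet_Icc)
      filter_upwards [h1, h2] with q h1 h2
      push_cast
      exact ⟨add_nonneg h1.1 h2.1, add_le_add h1.2 h2.2⟩
    -- Convolution with one more uniform law: `ν` is the law of a sum of independent uniform
    -- variables on `[0, 1]`.
    refine ⟨(ν.prod lam).map (fun q => q.1 + q.2),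
      Measure.isProbabilityMeasure_map hm.aemeasurable, ?_, ?_⟩
    · exact (ae_map_iff (p := fun t => t ∈ Icc (0 : ℝ) (m + 1 : ℕ)) hm.aemeasurable
        measurableSet_Icc).2 hae
    · intro V _ _ φ hφ s x
      have hD : ContDiff ℝ ((⊤ : ℕ∞) : WithTop ℕ∞) (Δ_[s] φ) := by
        have : Δ_[s] φ = fun x => φ (x + s) - φ x := by ext; simp [fwdDiff]
        rw [this]
        exact (hφ.comp (contDiff_id.add contDiff_const)).sub hφ
      have hcont : Continuous
          (fun t : ℝ => iteratedFDeriv ℝ (m + 1) φ (x + t • s) (fun _ => s)) :=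
        (continuous_iteratedFDeriv_diag hφ (m + 1) s).comp (by fun_prop)
      rw [Function.iterate_succ_apply, h V _ hD, integral_map hm.aemeasurable
        hcont.aestronglyMeasurable, integral_prod]
      · refine integral_congr_ae (ae_of_all _ fun t => ?_)
        simp only [iteratedFDeriv_fwdDiff hφ]
        refine integral_congr_ae (ae_of_all _ fun τ => ?_)
        simp only [add_smul, add_assoc]
      · obtain ⟨C, hC⟩ := isCompact_Icc.exists_bound_of_continuousOn
          (s := Icc (0 : ℝ) (m + 1 : ℕ)) hcont.continuousOn
        refine Integrable.of_bound (C := C)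
          (hcont.comp (continuous_fst.add continuous_snd)).aestronglyMeasurable ?_
        filter_upwards [hae] with q hq
        exact hC _ hq

end Spline

/-- Expansion of the diagonal of the `k`-th derivative along the standard basis. -/
theorem iteratedFDeriv_diag_eq_sum {N k : ℕ} (φ : E N → ℝ) (x s : E N) :
    iteratedFDeriv ℝ k φ x (fun _ => s) =
      ∑ I : Fin k → Fin N, (∏ j, s (I j)) * partialDeriv I φ x := by
  have hs : s = ∑ i, s i • EuclideanSpace.single i (1 : ℝ) := by
    simpa using ((EuclideanSpace.basisFun (Fin N) ℝ).sum_repr s).symm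
  conv_lhs => rw [hs]
  rw [ContinuousMultilinearMap.map_sum]
  refine Finset.sum_congr rfl fun I _ => ?_
  rw [ContinuousMultilinearMap.map_smul_univ]
  rfl

/-! ### Translations and shears in `L^q`. -/

section Translation

variable {N : ℕ} {Y : Type*} [MeasurableSpace Y]

/-- For fixed `y` the shear is a translation, which preserves volume. This gives `(t, x) ↦ f (x + t
• s)` joint measurability even though `f` is only a.e. measurable. -/
theorem measurePreserving_shear (ν : Measure Y) [SFinite ν] {L : Y → E N} (hL : Measurable L) :
    MeasurePreserving (fun z : Y × E N => (z.1, z.2 + L z.1))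
      (ν.prod volume) (ν.prod volume) := by
  refine (MeasurePreserving.id ν).skew_product (g := fun y x => x + L y)
    (by unfold Function.uncurry; fun_prop) (ae_of_all _ fun y => ?_)
  exact (measurePreserving_add_right volume (L y)).map_eq

theorem quasiMeasurePreserving_shear_snd (ν : Measure Y) [SFinite ν] {L : Y → E N}
    (hL : Measurable L) :
    Measure.QuasiMeasurePreserving (fun z : Y × E N => z.2 + L z.1) (ν.prod volume) volume :=
  Measure.quasiMeasurePreserving_snd.comp (measurePreserving_shear ν hL).quasiMeasurePreserving

theorem memLp_shear {q : ℝ≥0∞} {f : E N → ℝ} (hf : MemLp f q volume) (ν : Measure Y)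
    [IsFiniteMeasure ν] {L : Y → E N} (hL : Measurable L) :
    MemLp (fun z : Y × E N => f (z.2 + L z.1)) q (ν.prod volume) :=
  (hf.comp_snd ν).comp_measurePreserving (measurePreserving_shear ν hL)

theorem memLp_translate {q : ℝ≥0∞} {f : E N → ℝ} (hf : MemLp f q volume) (v : E N) :
    MemLp (fun x => f (x + v)) q volume :=
  hf.comp_measurePreserving (measurePreserving_add_right volume v)

theorem eLpNorm_translate {q : ℝ≥0∞} {f : E N → ℝ} (hf : AEStronglyMeasurable f volume)
    (v : E N) : eLpNorm (fun x => f (x + v)) q volume = eLpNorm f q volume :=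
  eLpNorm_comp_measurePreserving hf (measurePreserving_add_right volume v)

theorem memLp_fwdDiff_iter {q : ℝ≥0∞} {f : E N → ℝ} (hf : MemLp f q volume) (s : E N) (n : ℕ) :
    MemLp ((fwdDiff s)^[n] f) q volume := by
  induction n generalizing f with
  | zero => simpa using hf
  | succ n ih =>
    rw [Function.iterate_succ_apply]
    exact ih ((memLp_translate hf s).sub hf)

/-- Continuity of translations in `L^q`. -/
theorem tendsto_eLpNorm_translate_sub {q : ℝ≥0∞} (hq1 : 1 ≤ q) (hq : q ≠ ∞) {f : E N → ℝ}
    (hf : MemLp f q volume) :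
    Tendsto (fun v : E N => eLpNorm (fun x => f (x + v) - f x) q volume) (𝓝 0) (𝓝 0) := by
  have : Fact (1 ≤ q) := ⟨hq1⟩
  have : Fact (q ≠ ∞) := ⟨hq⟩
  have hc : Continuous (fun v : E N => (DomAddAct.mk v) +ᵥ (hf.toLp f)) :=
    (DomAddAct.continuous_mk.vadd continuous_const)
  have h0 : Tendsto (fun v : E N => edist ((DomAddAct.mk v) +ᵥ (hf.toLp f)) (hf.toLp f))
      (𝓝 0) (𝓝 0) := by
    have := (hc.edist (continuous_const (y := hf.toLp f))).tendsto 0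
    simpa using this
  refine h0.congr fun v => ?_
  rw [DomAddAct.mk_vadd_toLp, Lp.edist_toLp_toLp]
  refine eLpNorm_congr_ae (ae_of_all _ fun x => ?_)
  simp [add_comm]

end Translation

/-! ### Summation by parts for differences. -/

section Duality

variable {N : ℕ} {p q : ℝ≥0∞} [p.HolderConjugate q]

theorem integral_mul_fwdDiff {f φ : E N → ℝ} (hf : MemLp f p volume) (hφ : MemLp φ q volume)
    (s : E N) : ∫ x, φ x * (Δ_[s] f) x = ∫ x, (Δ_[-s] φ) x * f x := by
  have : q.HolderConjugate p := ENNReal.HolderConjugate.symm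
  have h := integral_add_right_eq_self (μ := (volume : Measure (E N)))
    (fun x => φ (x + -s) * f x) s
  simp only [add_neg_cancel_right] at h
  simp only [fwdDiff, mul_sub, sub_mul]
  rw [integral_sub, integral_sub, h]
  · exact (memLp_translate hφ (-s)).integrable_mul hf
  · exact hφ.integrable_mul hf
  · exact hφ.integrable_mul (memLp_translate hf s)
  · exact hφ.integrable_mul hf

theorem integral_mul_fwdDiff_iter {f φ : E N → ℝ} (hf : MemLp f p volume)
    (hφ : MemLp φ q volume) (s : E N) (n : ℕ) :
    ∫ x, φ x * ((fwdDiff s)^[n] f) x = ∫ x, ((fwdDiff (-s))^[n] φ) x * f x := by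
  induction n generalizing f with
  | zero => simp
  | succ n ih =>
    rw [Function.iterate_succ_apply, Function.iterate_succ_apply',
      ih (f := Δ_[s] f) (memLp_fwdDiff_iter hf s 1), ← integral_mul_fwdDiff hf (memLp_fwdDiff_iter hφ _ n)]

end Duality

/-! ### Averaging inequalities. -/

section Jensen

variable {α β : Type*} [MeasurableSpace α] [MeasurableSpace β]

theorem lintegral_rpow_le_lintegral_rpow {r : ℝ} (hr : 1 ≤ r) (ν : Measure α)
    [IsProbabilityMeasure ν] {u : α → ℝ≥0∞} (hu : AEMeasurable u ν) :
    (∫⁻ t, u t ∂ν) ^ r ≤ ∫⁻ t, u t ^ r ∂ν := by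
  have h := eLpNorm'_le_eLpNorm'_mul_rpow_measure_univ (μ := ν) (p := 1) (q := r) (f := u)
    one_pos hr hu.aestronglyMeasurable
  simp only [eLpNorm', enorm_eq_self, ENNReal.rpow_one, div_one, measure_univ,
    ENNReal.one_rpow, mul_one] at h
  have hr0 : 0 < r := by linarith
  calc (∫⁻ t, u t ∂ν) ^ r ≤ ((∫⁻ t, u t ^ r ∂ν) ^ (1 / r)) ^ r := by gcongr
    _ = _ := by rw [← ENNReal.rpow_mul, one_div_mul_cancel hr0.ne', ENNReal.rpow_one]

/-- Jensen in `t`, then Tonelli. It serves as a substitute for Minkowski's integral inequality. -/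
theorem lintegral_enorm_integral_rpow_le {r : ℝ} (hr : 1 ≤ r) (ν : Measure α)
    [IsProbabilityMeasure ν] (μ : Measure β) [SFinite μ] {F : α × β → ℝ}
    (hF : AEStronglyMeasurable F (ν.prod μ)) :
    ∫⁻ x, ‖∫ t, F (t, x) ∂ν‖ₑ ^ r ∂μ ≤ ∫⁻ t, ∫⁻ x, ‖F (t, x)‖ₑ ^ r ∂μ ∂ν := by
  have hr0 : 0 ≤ r := by linarith
  rw [lintegral_lintegral_swap (hF.enorm.pow_const r)]
  have h : ∀ᵐ x ∂μ, AEStronglyMeasurable (fun t => F (t, x)) ν :=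
    (hF.prod_swap).prodMk_left
  refine lintegral_mono_ae ?_
  filter_upwards [h] with x hx
  calc ‖∫ t, F (t, x) ∂ν‖ₑ ^ r ≤ (∫⁻ t, ‖F (t, x)‖ₑ ∂ν) ^ r := by
        gcongr; exact enorm_integral_le_lintegral_enorm _
    _ ≤ _ := lintegral_rpow_le_lintegral_rpow hr ν hx.enorm

end Jensen

/-! ### Peano's formula for weakly differentiable functions. -/

section Representation

variable {N : ℕ}

theorem memLp_integral_shear {r : ℝ} (hr : 1 ≤ r) {g : E N → ℝ}
    (hg : MemLp g (ENNReal.ofReal r) volume) (ν : Measure ℝ) [IsProbabilityMeasure ν] (s : E N) :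
    MemLp (fun x => ∫ t, g (x + t • s) ∂ν) (ENNReal.ofReal r) volume := by
  have hF := memLp_shear hg ν (L := fun t : ℝ => t • s) (by fun_prop)
  have hr0 : ENNReal.ofReal r ≠ 0 := by simpa using (by linarith : 0 < r)
  have hrr : (ENNReal.ofReal r).toReal = r := ENNReal.toReal_ofReal (by linarith)
  refine ⟨hF.1.prod_swap.integral_prod_right', ?_⟩
  have h1 := hF.2
  rw [eLpNorm_lt_top_iff_lintegral_rpow_enorm_lt_top hr0 ENNReal.ofReal_ne_top, hrr] at h1 ⊢
  refine lt_of_le_of_lt (lintegral_enorm_integral_rpow_le hr ν volume hF.1) ?_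
  rwa [lintegral_prod _ (hF.1.enorm.pow_const r)] at h1

/-- Both sides are tested against `φ`. The differences move onto `φ`, where the smooth formula with
step `-s` applies; after Fubini, the weak derivative identity for translates of `φ` brings in `g`.
No smooth approximation of `f` is involved. -/
theorem fwdDiff_iter_ae_eq {m : ℕ} {r : ℝ} (hr : 1 < r) {ν : Measure ℝ} [IsProbabilityMeasure ν]
    (hν : ∀ φ : E N → ℝ, ContDiff ℝ ((⊤ : ℕ∞) : WithTop ℕ∞) φ → ∀ s x : E N,
      ((fwdDiff s)^[m] φ) x = ∫ t, iteratedFDeriv ℝ m φ (x + t • s) (fun _ => s) ∂ν)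
    {f g : E N → ℝ} (hf : MemLp f (ENNReal.ofReal r) volume)
    (hg : MemLp g (ENNReal.ofReal r) volume) (s : E N)
    (hfg : ∀ φ : E N → ℝ, ContDiff ℝ ((⊤ : ℕ∞) : WithTop ℕ∞) φ → HasCompactSupport φ →
      ∫ x, f x * iteratedFDeriv ℝ m φ x (fun _ => s) = (-1 : ℝ) ^ m * ∫ x, g x * φ x) :
    ∀ᵐ x, ((fwdDiff s)^[m] f) x = ∫ t, g (x + t • s) ∂ν := by
  obtain ⟨q, hq⟩ : ∃ q, (ENNReal.ofReal r).HolderConjugate q :=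
    ⟨_, (Real.HolderConjugate.conjExponent hr).ennrealOfReal⟩
  have hq' : q.HolderConjugate (ENNReal.ofReal r) := ENNReal.HolderConjugate.symm
  have hr1 : 1 ≤ ENNReal.ofReal r := by simpa using ENNReal.ofReal_le_ofReal hr.le
  refine ae_eq_of_integral_contDiff_smul_eq
    ((memLp_fwdDiff_iter hf s m).locallyIntegrable hr1)
    ((memLp_integral_shear hr.le hg ν s).locallyIntegrable hr1) fun φ hφ hφc => ?_
  have hφq : MemLp φ q volume := hφ.continuous.memLp_of_hasCompactSupport hφc
  set D : E N → ℝ := fun x => iteratedFDeriv ℝ m φ x (fun _ => s) with hD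
  have hDc : HasCompactSupport D :=
    (hφc.iteratedFDeriv (𝕜 := ℝ) m).comp_left
      (g := fun A : ContinuousMultilinearMap ℝ (fun _ : Fin m => E N) ℝ => A (fun _ => s)) rfl
  have hDq : MemLp D q volume :=
    (continuous_iteratedFDeriv_diag hφ m s).memLp_of_hasCompactSupport hDc
  have hF := memLp_shear hg ν (L := fun t : ℝ => t • s) (by fun_prop)
  have hDs := memLp_shear hDq ν (L := fun t : ℝ => -(t • s)) (by fun_prop)
  have hI1 : Integrable (fun z : ℝ × E N => f z.2 * D (z.2 + -(z.1 • s))) (ν.prod volume) :=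
    (hf.comp_snd ν).integrable_mul hDs
  have hI2 : Integrable (fun z : ℝ × E N => φ z.2 * g (z.2 + z.1 • s)) (ν.prod volume) :=
    (hφq.comp_snd ν).integrable_mul hF
  -- Multilinearity turns the step `-s` into a sign `(-1)^m`, which later cancels the one from the
  -- weak derivative.
  have hneg : ∀ x, ((fwdDiff (-s))^[m] φ) x = (-1) ^ m * ∫ t, D (x + -(t • s)) ∂ν := by
    intro x
    rw [hν φ hφ (-s) x, ← integral_const_mul]
    refine integral_congr_ae (ae_of_all _ fun t => ?_)
    have h := (iteratedFDeriv ℝ m φ (x + -(t • s))).map_smul_univ (fun _ => (-1 : ℝ)) (fun _ => s)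
    simpa [hD] using h
  have hinner : ∀ t : ℝ, ∫ x, f x * D (x + -(t • s)) = (-1) ^ m * ∫ x, φ x * g (x + t • s) := by
    intro t
    have hψ := hfg (fun x => φ (x + -(t • s))) (hφ.comp (contDiff_id.add contDiff_const))
      (hφc.comp_homeomorph (Homeomorph.addRight (-(t • s))))
    simp only [iteratedFDeriv_comp_add_right] at hψ
    rw [hψ]
    congr 1
    have := integral_add_right_eq_self (μ := (volume : Measure (E N)))
      (fun x => g x * φ (x + -(t • s))) (t • s)
    rw [← this]
    simp only [add_neg_cancel_right, mul_comm]
  simp only [smul_eq_mul]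
  rw [integral_mul_fwdDiff_iter hf hφq]
  calc ∫ x, ((fwdDiff (-s))^[m] φ) x * f x
      = ∫ x, (-1) ^ m * ∫ t, f x * D (x + -(t • s)) ∂ν := by
        refine integral_congr_ae (ae_of_all _ fun x => ?_)
        simp only [hneg, integral_const_mul]
        ring
    _ = (-1) ^ m * ∫ t, (∫ x, f x * D (x + -(t • s))) ∂ν := by
        rw [integral_const_mul, integral_integral_swap (f := fun t x => f x * D (x + -(t • s))) hI1]
    _ = ∫ t, (∫ x, φ x * g (x + t • s)) ∂ν := by
        simp only [hinner, integral_const_mul]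
        rw [← mul_assoc, ← mul_pow]
        simp
    _ = ∫ x, ∫ t, φ x * g (x + t • s) ∂ν := integral_integral_swap hI2
    _ = _ := by simp only [integral_const_mul]

end Representation

/-! ### Weak derivatives and the `L^p` comparison of differences with differentials. -/

variable {N : ℕ}

theorem HasWeakPartialDeriv.ae_eq {k : ℕ} {I : Fin k → Fin N} {f g g' : E N → ℝ}
    (h : HasWeakPartialDeriv I f g) (h' : HasWeakPartialDeriv I f g') : g =ᵐ[volume] g' := by
  refine ae_eq_of_integral_contDiff_smul_eq h.locallyIntegrable_deriv h'.locallyIntegrable_deriv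
    fun φ hφ hφc => ?_
  have h1 := (h.integral_eq φ hφ hφc).symm.trans (h'.integral_eq φ hφ hφc)
  have h2 : (-1 : ℝ) ^ k ≠ 0 := pow_ne_zero _ (by norm_num)
  simpa only [smul_eq_mul, mul_comm] using mul_left_cancel₀ h2 h1

theorem MemSobolev.hasWeakPartialDeriv {m k : ℕ} {p : ℝ} {f : E N → ℝ} (hf : MemSobolev m p f)
    (hk : k ≤ m) (I : Fin k → Fin N) : HasWeakPartialDeriv I f (weakPartialDeriv I f) := by
  obtain ⟨g, -, hg⟩ := hf.2 k hk I
  have h : ∃ g, HasWeakPartialDeriv I f g := ⟨g, hg⟩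
  rw [weakPartialDeriv, dif_pos h]
  exact h.choose_spec

theorem MemSobolev.memLp_weakPartialDeriv {m k : ℕ} {p : ℝ} {f : E N → ℝ}
    (hf : MemSobolev m p f) (hk : k ≤ m) (I : Fin k → Fin N) :
    MemLp (weakPartialDeriv I f) (ENNReal.ofReal p) volume := by
  obtain ⟨g, hgp, hg⟩ := hf.2 k hk I
  exact (memLp_congr_ae (hg.ae_eq (hf.hasWeakPartialDeriv hk I))).1 hgp

theorem MemSobolev.memLp_weakDiff {m : ℕ} {p : ℝ} {f : E N → ℝ} (hf : MemSobolev m p f)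
    (s : E N) : MemLp (fun x => weakDiff m f x s) (ENNReal.ofReal p) volume := by
  unfold weakDiff
  exact memLp_finsetSum _ fun I _ => (hf.memLp_weakPartialDeriv le_rfl I).const_mul _

theorem MemSobolev.integral_mul_iteratedFDeriv {m : ℕ} {p : ℝ} (hp : 1 ≤ p) {f : E N → ℝ}
    (hf : MemSobolev m p f) (s : E N) {φ : E N → ℝ}
    (hφ : ContDiff ℝ ((⊤ : ℕ∞) : WithTop ℕ∞) φ) (hφc : HasCompactSupport φ) :
    ∫ x, f x * iteratedFDeriv ℝ m φ x (fun _ => s) =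
      (-1 : ℝ) ^ m * ∫ x, weakDiff m f x s * φ x := by
  have hp1 : 1 ≤ ENNReal.ofReal p := by simpa using ENNReal.ofReal_le_ofReal hp
  simp only [iteratedFDeriv_diag_eq_sum, weakDiff, Finset.mul_sum, Finset.sum_mul]
  rw [integral_finsetSum, integral_finsetSum, Finset.mul_sum]
  · refine Finset.sum_congr rfl fun I _ => ?_
    simp only [mul_left_comm (f _) (∏ j, s (I j)), mul_assoc, integral_const_mul]
    rw [(hf.hasWeakPartialDeriv le_rfl I).integral_eq φ hφ hφc]
    ring
  · intro I _
    simp only [mul_assoc]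
    refine Integrable.const_mul ?_ _
    simpa only [smul_eq_mul, mul_comm] using
      ((hf.memLp_weakPartialDeriv le_rfl I).locallyIntegrable
        hp1).integrable_smul_left_of_hasCompactSupport hφ.continuous hφc
  · intro I _
    simp only [mul_left_comm (f _) (∏ j, s (I j))]
    refine Integrable.const_mul ?_ _
    have hcont : Continuous (partialDeriv I φ) :=
      (ContinuousMultilinearMap.apply ℝ (fun _ : Fin m => E N) ℝ
        (fun j => EuclideanSpace.single (I j) (1 : ℝ))).continuous.comp
        (hφ.continuous_iteratedFDeriv (m := m) (by exact_mod_cast le_top))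
    have hcs : HasCompactSupport (partialDeriv I φ) :=
      (hφc.iteratedFDeriv (𝕜 := ℝ) m).comp_left
        (g := fun A : ContinuousMultilinearMap ℝ (fun _ : Fin m => E N) ℝ =>
          A (fun j => EuclideanSpace.single (I j) (1 : ℝ))) rfl
    simpa only [smul_eq_mul, mul_comm] using
      (hf.1.locallyIntegrable hp1).integrable_smul_left_of_hasCompactSupport hcont hcs

theorem enorm_prod_coord_le {k : ℕ} (s : E N) (I : Fin k → Fin N) :
    ‖∏ j, s (I j)‖ₑ ≤ ENNReal.ofReal (‖s‖ ^ k) := by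
  rw [← ofReal_norm]
  refine ENNReal.ofReal_le_ofReal ?_
  rw [norm_prod]
  calc ∏ j, ‖s (I j)‖ ≤ ∏ _j : Fin k, ‖s‖ :=
        Finset.prod_le_prod (fun _ _ => norm_nonneg _) fun j _ => PiLp.norm_apply_le s (I j)
    _ = ‖s‖ ^ k := by simp

theorem eLpNorm_sum_coord_mul_le {k : ℕ} {q : ℝ≥0∞} (hq : 1 ≤ q) (s : E N)
    {u : (Fin k → Fin N) → E N → ℝ} (hu : ∀ I, AEStronglyMeasurable (u I) volume) :
    eLpNorm (fun x => ∑ I, (∏ j, s (I j)) * u I x) q volume ≤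
      ENNReal.ofReal (‖s‖ ^ k) * ∑ I, eLpNorm (u I) q volume := by
  have h0 : (fun x => ∑ I, (∏ j, s (I j)) * u I x) = ∑ I, (∏ j, s (I j)) • u I := by
    ext x; simp
  rw [h0]
  refine (eLpNorm_sum_le (fun I _ => (hu I).const_smul _) hq).trans ?_
  rw [Finset.mul_sum]
  refine Finset.sum_le_sum fun I _ => ?_
  rw [eLpNorm_const_smul]
  gcongr
  exact enorm_prod_coord_le s I

/-- The total `L^q` oscillation under translation by `v` of the `m`-th weak derivatives. -/
noncomputable def weakDerivModulus (m : ℕ) (q : ℝ≥0∞) (f : E N → ℝ) (v : E N) : ℝ≥0∞ :=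
  ∑ I : Fin m → Fin N,
    eLpNorm (fun x => weakPartialDeriv I f (x + v) - weakPartialDeriv I f x) q volume

theorem MemSobolev.tendsto_weakDerivModulus {m : ℕ} {p : ℝ} (hp : 1 ≤ p) {f : E N → ℝ}
    (hf : MemSobolev m p f) :
    Tendsto (weakDerivModulus m (ENNReal.ofReal p) f) (𝓝 0) (𝓝 0) := by
  have hp1 : 1 ≤ ENNReal.ofReal p := by simpa using ENNReal.ofReal_le_ofReal hp
  have h := tendsto_finsetSum (Finset.univ : Finset (Fin m → Fin N)) fun I _ =>
    tendsto_eLpNorm_translate_sub hp1 ENNReal.ofReal_ne_top (hf.memLp_weakPartialDeriv le_rfl I)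
  rw [Finset.sum_const_zero] at h
  exact h

theorem MemSobolev.weakDerivModulus_le {m : ℕ} {p : ℝ} (hp : 1 ≤ p) {f : E N → ℝ}
    (hf : MemSobolev m p f) (v : E N) :
    weakDerivModulus m (ENNReal.ofReal p) f v ≤
      2 * ∑ I : Fin m → Fin N, eLpNorm (weakPartialDeriv I f) (ENNReal.ofReal p) volume := by
  have hp1 : 1 ≤ ENNReal.ofReal p := by simpa using ENNReal.ofReal_le_ofReal hp
  rw [Finset.mul_sum]
  refine Finset.sum_le_sum fun I _ => ?_
  have hI := hf.memLp_weakPartialDeriv le_rfl I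
  refine (eLpNorm_sub_le (memLp_translate hI v).1 hI.1 hp1).trans ?_
  rw [eLpNorm_translate hI.1, two_mul]

theorem eLpNorm_ofReal_rpow {p : ℝ} (hp : 0 < p) (u : E N → ℝ) :
    eLpNorm u (ENNReal.ofReal p) volume ^ p = ∫⁻ x, ‖u x‖ₑ ^ p := by
  rw [eLpNorm_eq_lintegral_rpow_enorm_toReal (by simpa using hp) ENNReal.ofReal_ne_top,
    ENNReal.toReal_ofReal hp.le, ← ENNReal.rpow_mul, one_div_mul_cancel hp.ne', ENNReal.rpow_one]

/-- The `m`-th finite difference of a Sobolev function is close in `L^p` to its `m`-th differential,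
with an error controlled by the modulus of continuity of the weak derivatives. -/
theorem MemSobolev.eLpNorm_fwdDiff_sub_weakDiff_le {m : ℕ} {p : ℝ} (hp : 1 < p) {f : E N → ℝ}
    (hf : MemSobolev m p f) {s : E N} {η : ℝ≥0∞}
    (hη : ∀ v : E N, ‖v‖ ≤ m * ‖s‖ → weakDerivModulus m (ENNReal.ofReal p) f v ≤ η) :
    eLpNorm (fun x => ((fwdDiff s)^[m] f) x - weakDiff m f x s) (ENNReal.ofReal p) volume ≤
      ENNReal.ofReal (‖s‖ ^ m) * η := by
  have hp0 : 0 < p := by linarith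
  have hp1 : 1 ≤ ENNReal.ofReal p := by simpa using ENNReal.ofReal_le_ofReal hp.le
  have hrr : (ENNReal.ofReal p).toReal = p := ENNReal.toReal_ofReal hp0.le
  obtain ⟨ν, hνp, hνs, hν⟩ := exists_peano_measure m
  set g : E N → ℝ := fun x => weakDiff m f x s with hg
  have hgL : MemLp g (ENNReal.ofReal p) volume := hf.memLp_weakDiff s
  have hrep := fwdDiff_iter_ae_eq hp (hν (E N)) hf.1 hgL s
    (fun φ hφ hφc => hf.integral_mul_iteratedFDeriv hp.le s hφ hφc)
  have hG := memLp_shear hgL ν (L := fun t : ℝ => t • s) (by fun_prop)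
  -- Fubini makes `|g (x + t • s)|^p` integrable in `t` for a.e. `x`; since `ν` is finite and `p ≥
  -- 1`, so is `g (x + t • s)`.
  have hint : ∀ᵐ x, Integrable (fun t : ℝ => g (x + t • s)) ν := by
    have h1 := hG.integrable_norm_rpow (by simpa using hp0) ENNReal.ofReal_ne_top
    rw [hrr] at h1
    filter_upwards [h1.prod_left_ae, hG.1.prod_swap.prodMk_left] with x hx hx'
    refine MemLp.integrable hp1 ((integrable_norm_rpow_iff hx' (by simpa using hp0)
      ENNReal.ofReal_ne_top).1 ?_)
    rwa [hrr]
  have hF : AEStronglyMeasurable (fun z : ℝ × E N => g (z.2 + z.1 • s) - g z.2)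
      (ν.prod volume) := hG.1.sub (hgL.comp_snd ν).1
  rw [← ENNReal.rpow_le_rpow_iff hp0, eLpNorm_ofReal_rpow hp0]
  calc ∫⁻ x, ‖((fwdDiff s)^[m] f) x - g x‖ₑ ^ p
      = ∫⁻ x, ‖∫ t, (g (x + t • s) - g x) ∂ν‖ₑ ^ p := by
        refine lintegral_congr_ae ?_
        filter_upwards [hrep, hint] with x hx hxi
        rw [hx, integral_sub hxi (integrable_const _)]
        simp
    _ ≤ ∫⁻ t, ∫⁻ x, ‖g (x + t • s) - g x‖ₑ ^ p ∂volume ∂ν :=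
        lintegral_enorm_integral_rpow_le hp.le ν volume hF
    _ ≤ ∫⁻ _t, (ENNReal.ofReal (‖s‖ ^ m) * η) ^ p ∂ν := by
        refine lintegral_mono_ae ?_
        filter_upwards [hνs] with t ht
        rw [← eLpNorm_ofReal_rpow hp0 (fun x => g (x + t • s) - g x)]
        gcongr
        have hsum : (fun x => g (x + t • s) - g x) = fun x => ∑ I : Fin m → Fin N,
            (∏ j, s (I j)) * (weakPartialDeriv I f (x + t • s) - weakPartialDeriv I f x) := by
          ext x
          simp only [hg, weakDiff, mul_sub, Finset.sum_sub_distrib]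
        rw [hsum]
        refine (eLpNorm_sum_coord_mul_le hp1 s
          (u := fun I x => weakPartialDeriv I f (x + t • s) - weakPartialDeriv I f x) fun I => ?_).trans ?_
        · have hI := hf.memLp_weakPartialDeriv le_rfl I
          exact (memLp_translate hI _).1.sub hI.1
        · gcongr
          refine hη _ ?_
          rw [norm_smul, Real.norm_of_nonneg ht.1]
          exact mul_le_mul_of_nonneg_right ht.2 (norm_nonneg _)
    _ = _ := by simp

/-! ### From `L^p` norms to integrals of `p`-th powers. -/

theorem finiteDiff_add_eq {m : ℕ} (hm : 1 ≤ m) (f : E N → ℝ) (x h : E N) :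
    finiteDiff m f x (x + h) = (-1) ^ m * ((fwdDiff ((m : ℝ)⁻¹ • h))^[m] f) x := by
  have hm0 : (m : ℝ) ≠ 0 := by positivity
  rw [fwdDiff_iter_eq_sum_shift, finiteDiff, Finset.mul_sum]
  refine Finset.sum_congr rfl fun j hj => ?_
  have hjm : j ≤ m := Nat.lt_succ_iff.1 (Finset.mem_range.1 hj)
  have h1 : (((m : ℝ) - j) / m) • x + ((j : ℝ) / m) • (x + h) = x + j • ((m : ℝ)⁻¹ • h) := by
    rw [smul_add, ← add_assoc, ← add_smul, ← Nat.cast_smul_eq_nsmul ℝ, smul_smul]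
    congr 1
    rw [← add_div, sub_add_cancel, div_self hm0, one_smul]
  have h2 : (-1 : ℝ) ^ m * (-1) ^ (m - j) = (-1) ^ j := by
    obtain ⟨i, rfl⟩ := Nat.exists_eq_add_of_le hjm
    rw [Nat.add_sub_cancel_left, pow_add, mul_assoc, ← mul_pow]
    simp
  rw [h1, zsmul_eq_mul, ← h2]
  push_cast
  ring

theorem weakDiff_smul {k : ℕ} (f : E N → ℝ) (x h : E N) (c : ℝ) :
    weakDiff k f x (c • h) = c ^ k * weakDiff k f x h := by
  simp only [weakDiff, Finset.mul_sum, PiLp.smul_apply, smul_eq_mul, Finset.prod_mul_distrib,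
    Finset.prod_const, Finset.card_univ, Fintype.card_fin, mul_assoc]

theorem abs_toReal_eLpNorm_sub_le {q : ℝ≥0∞} (hq : 1 ≤ q) {u w : E N → ℝ}
    (hu : MemLp u q volume) (hw : MemLp w q volume) :
    |(eLpNorm u q volume).toReal - (eLpNorm w q volume).toReal| ≤
      (eLpNorm (fun x => u x - w x) q volume).toReal := by
  have : Fact (1 ≤ q) := ⟨hq⟩
  have h := abs_norm_sub_norm_le (hu.toLp u) (hw.toLp w)
  rw [← MemLp.toLp_sub, Lp.norm_toLp, Lp.norm_toLp, Lp.norm_toLp] at h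
  exact h

theorem integral_abs_rpow_eq {p : ℝ} (hp : 0 < p) {u : E N → ℝ}
    (hu : MemLp u (ENNReal.ofReal p) volume) :
    ∫ x, |u x| ^ p = (eLpNorm u (ENNReal.ofReal p) volume).toReal ^ p := by
  rw [ENNReal.toReal_rpow, eLpNorm_ofReal_rpow hp, integral_eq_lintegral_of_nonneg_ae]
  · congr 1
    refine lintegral_congr fun x => ?_
    rw [← ofReal_norm, ENNReal.ofReal_rpow_of_nonneg (norm_nonneg _) hp.le, Real.norm_eq_abs]
  · exact ae_of_all _ fun x => by positivity
  · exact (hu.1.norm.aemeasurable.pow_const p).aestronglyMeasurable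

theorem exists_forall_abs_rpow_sub_rpow_le {p : ℝ} (hp : 0 < p) (B : ℝ) {η : ℝ} (hη : 0 < η) :
    ∃ δ > 0, ∀ u ∈ Icc 0 B, ∀ w ∈ Icc 0 B, |u - w| ≤ δ → |u ^ p - w ^ p| ≤ η := by
  have h := isCompact_Icc.uniformContinuousOn_of_continuous
    ((Real.continuous_rpow_const hp.le).continuousOn (s := Icc 0 B))
  obtain ⟨δ, hδ, h⟩ := Metric.uniformContinuousOn_iff.1 h η hη
  refine ⟨δ / 2, half_pos hδ, fun u hu w hw huw => (h u hu w hw ?_).le⟩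
  rw [Real.dist_eq]
  linarith

theorem MemSobolev.exists_bound_eLpNorm {m : ℕ} {p : ℝ} (hp : 1 < p) {f : E N → ℝ}
    (hf : MemSobolev m p f) : ∃ B : ℝ, 0 ≤ B ∧ ∀ s : E N,
      (eLpNorm ((fwdDiff s)^[m] f) (ENNReal.ofReal p) volume).toReal ≤ B * ‖s‖ ^ m ∧
      (eLpNorm (fun x => weakDiff m f x s) (ENNReal.ofReal p) volume).toReal ≤ B * ‖s‖ ^ m := by
  have hp1 : 1 ≤ ENNReal.ofReal p := by simpa using ENNReal.ofReal_le_ofReal hp.le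
  set S := ∑ I : Fin m → Fin N, eLpNorm (weakPartialDeriv I f) (ENNReal.ofReal p) volume with hS
  have hSf : S ≠ ∞ := by
    rw [hS]
    exact (ENNReal.sum_lt_top.2 fun I _ => (hf.memLp_weakPartialDeriv le_rfl I).2).ne
  have hS0 : 0 ≤ S.toReal := ENNReal.toReal_nonneg
  -- The differential contributes `S`, and the crude bound on the modulus contributes `2 * S`.
  refine ⟨3 * S.toReal, by positivity, fun s => ?_⟩
  have hσ : 0 ≤ ‖s‖ ^ m := by positivity
  have h1 := hf.eLpNorm_fwdDiff_sub_weakDiff_le hp (s := s)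
    fun v _ => hf.weakDerivModulus_le hp.le v
  have h2 : eLpNorm (fun x => weakDiff m f x s) (ENNReal.ofReal p) volume ≤
      ENNReal.ofReal (‖s‖ ^ m) * S :=
    eLpNorm_sum_coord_mul_le hp1 s fun I => (hf.memLp_weakPartialDeriv le_rfl I).1
  have h1' := ENNReal.toReal_mono (by finiteness) h1
  have h2' := ENNReal.toReal_mono (by finiteness) h2
  rw [ENNReal.toReal_mul, ENNReal.toReal_ofReal hσ] at h1' h2'
  rw [ENNReal.toReal_mul, ENNReal.toReal_ofNat] at h1'
  have h3 := (abs_le.1 (abs_toReal_eLpNorm_sub_le hp1 (memLp_fwdDiff_iter hf.1 s m)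
    (hf.memLp_weakDiff s))).2
  have h4 : 0 ≤ ‖s‖ ^ m * S.toReal := by positivity
  constructor <;> nlinarith

theorem MemSobolev.exists_abs_eLpNorm_sub_le {m : ℕ} {p : ℝ} (hp : 1 < p) {f : E N → ℝ}
    (hf : MemSobolev m p f) {η : ℝ} (hη : 0 < η) : ∃ δ > 0, ∀ s : E N, ‖s‖ < δ →
      |(eLpNorm ((fwdDiff s)^[m] f) (ENNReal.ofReal p) volume).toReal -
        (eLpNorm (fun x => weakDiff m f x s) (ENNReal.ofReal p) volume).toReal| ≤ η * ‖s‖ ^ m := by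
  have hp1 : 1 ≤ ENNReal.ofReal p := by simpa using ENNReal.ofReal_le_ofReal hp.le
  have h := (hf.tendsto_weakDerivModulus hp.le).eventually
    (Iic_mem_nhds (ENNReal.ofReal_pos.2 hη))
  obtain ⟨δ, hδ, hball⟩ := Metric.eventually_nhds_iff.1 h
  -- The denominator `m + 1` gives `m * ‖s‖ < δ` and remains nonzero when `m = 0`.
  refine ⟨δ / (m + 1), by positivity, fun s hs => ?_⟩
  have hσ : 0 ≤ ‖s‖ ^ m := by positivity
  have h1 := hf.eLpNorm_fwdDiff_sub_weakDiff_le hp (s := s) (η := ENNReal.ofReal η) fun v hv => by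
    refine hball ?_
    rw [dist_zero_right]
    have : ‖s‖ * (m + 1) < δ := (lt_div_iff₀ (by positivity)).1 hs
    nlinarith [norm_nonneg s]
  have h1' := ENNReal.toReal_mono (by finiteness) h1
  rw [ENNReal.toReal_mul, ENNReal.toReal_ofReal hσ, ENNReal.toReal_ofReal hη.le] at h1'
  refine (abs_toReal_eLpNorm_sub_le hp1 (memLp_fwdDiff_iter hf.1 s m)
    (hf.memLp_weakDiff s)).trans ?_
  linarith

theorem MemSobolev.memLp_finiteDiff {m : ℕ} (hm : 1 ≤ m) {p : ℝ} {f : E N → ℝ}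
    (hf : MemSobolev m p f) (h : E N) :
    MemLp (fun x => finiteDiff m f x (x + h)) (ENNReal.ofReal p) volume := by
  simp only [finiteDiff_add_eq hm]
  exact (memLp_fwdDiff_iter hf.1 _ m).const_mul _

theorem MemSobolev.integral_finiteDiff_eq {m : ℕ} (hm : 1 ≤ m) {p : ℝ} (hp : 0 < p)
    {f : E N → ℝ} (hf : MemSobolev m p f) (h : E N) :
    ∫ x, |finiteDiff m f x (x + h)| ^ p =
      (eLpNorm ((fwdDiff ((m : ℝ)⁻¹ • h))^[m] f) (ENNReal.ofReal p) volume).toReal ^ p := by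
  rw [← integral_abs_rpow_eq hp (memLp_fwdDiff_iter hf.1 _ m)]
  simp only [finiteDiff_add_eq hm, abs_mul, abs_pow, abs_neg, abs_one, one_pow, one_mul]

theorem MemSobolev.exists_bound_integral {m : ℕ} (hm : 1 ≤ m) {p : ℝ} (hp : 1 < p) {f : E N → ℝ}
    (hf : MemSobolev m p f) : ∃ B : ℝ, 0 ≤ B ∧ ∀ h : E N,
      ∫ x, |finiteDiff m f x (x + h)| ^ p ≤ B * ‖h‖ ^ (m * p) ∧
      ∫ x, |weakDiff m f x h| ^ p ≤ B * ‖h‖ ^ (m * p) := by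
  have hp0 : 0 < p := by linarith
  obtain ⟨B, hB, H⟩ := hf.exists_bound_eLpNorm hp
  have key : ∀ h : E N, (B * ‖h‖ ^ m) ^ p = B ^ p * ‖h‖ ^ (m * p) := fun h => by
    rw [Real.mul_rpow hB (by positivity), ← Real.rpow_natCast, ← Real.rpow_mul (norm_nonneg _)]
  have hm1 : (1 : ℝ) ≤ m := by exact_mod_cast hm
  refine ⟨B ^ p, by positivity, fun h => ⟨?_, ?_⟩⟩
  · rw [hf.integral_finiteDiff_eq hm hp0, ← key]
    refine Real.rpow_le_rpow ENNReal.toReal_nonneg ((H _).1.trans ?_) hp0.le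
    gcongr
    rw [norm_smul, norm_inv, Real.norm_natCast]
    exact mul_le_of_le_one_left (norm_nonneg _) (inv_le_one_of_one_le₀ hm1)
  · rw [integral_abs_rpow_eq hp0 (hf.memLp_weakDiff h), ← key]
    exact Real.rpow_le_rpow ENNReal.toReal_nonneg (H _).2 hp0.le

/-- Divided by `‖s‖^m`, both norms lie in a fixed interval `[0, B]`, on which `t ↦ t^p` is uniformly
continuous; closeness of norms thus passes to `p`-th powers. -/
theorem MemSobolev.exists_abs_integral_sub_le {m : ℕ} (hm : 1 ≤ m) {p : ℝ} (hp : 1 < p)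
    {f : E N → ℝ} (hf : MemSobolev m p f) {η : ℝ} (hη : 0 < η) :
    ∃ δ > 0, ∀ h : E N, h ≠ 0 → ‖h‖ < δ →
      |(∫ x, |finiteDiff m f x (x + h)| ^ p) - (∫ x, |weakDiff m f x h| ^ p) / m ^ (m * p)| ≤
        η * ‖h‖ ^ (m * p) := by
  have hp0 : 0 < p := by linarith
  have hm1 : (1 : ℝ) ≤ m := by exact_mod_cast hm
  have hm0 : (0 : ℝ) < m := by linarith
  obtain ⟨B, hB, H⟩ := hf.exists_bound_eLpNorm hp
  obtain ⟨δ', hδ', hpow⟩ := exists_forall_abs_rpow_sub_rpow_le hp0 B hη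
  obtain ⟨δ, hδ, hsub⟩ := hf.exists_abs_eLpNorm_sub_le hp hδ'
  refine ⟨δ, hδ, fun h hh0 hh => ?_⟩
  set s : E N := (m : ℝ)⁻¹ • h with hs
  have hsn : ‖s‖ = ‖h‖ / m := by
    rw [hs, norm_smul, norm_inv, Real.norm_natCast]; ring
  have hhp : 0 < ‖h‖ := norm_pos_iff.2 hh0
  have hsle : ‖s‖ ≤ ‖h‖ := hsn ▸ div_le_self hhp.le hm1
  have hσ : 0 < ‖s‖ ^ m := by rw [hsn]; positivity
  -- The constant `m^{mp}` of the theorem comes from homogeneity, since the step is `s = h/m`.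
  have hW : (∫ x, |weakDiff m f x h| ^ p) / m ^ (m * p) =
      (eLpNorm (fun x => weakDiff m f x s) (ENNReal.ofReal p) volume).toReal ^ p := by
    rw [← integral_abs_rpow_eq hp0 (hf.memLp_weakDiff s)]
    have hcoef : |((m : ℝ)⁻¹) ^ m| ^ p = ((m : ℝ) ^ (m * p))⁻¹ := by
      rw [abs_of_nonneg (by positivity), inv_pow, Real.inv_rpow (by positivity),
        ← Real.rpow_natCast, ← Real.rpow_mul hm0.le]
    simp only [hs, weakDiff_smul, abs_mul, Real.mul_rpow (abs_nonneg _) (abs_nonneg _), hcoef,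
      integral_const_mul]
    ring
  rw [hf.integral_finiteDiff_eq hm hp0, hW]
  set u := (eLpNorm ((fwdDiff s)^[m] f) (ENNReal.ofReal p) volume).toReal with hu
  set w := (eLpNorm (fun x => weakDiff m f x s) (ENNReal.ofReal p) volume).toReal with hw
  have hu0 : 0 ≤ u := ENNReal.toReal_nonneg
  have hw0 : 0 ≤ w := ENNReal.toReal_nonneg
  have h1 := hpow (u / ‖s‖ ^ m) ⟨by positivity, (div_le_iff₀ hσ).2 (H s).1⟩
    (w / ‖s‖ ^ m) ⟨by positivity, (div_le_iff₀ hσ).2 (H s).2⟩ (by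
      rw [← sub_div, abs_div, abs_of_pos hσ, div_le_iff₀ hσ]
      exact hsub s (hsle.trans_lt hh))
  have hσp : 0 < (‖s‖ ^ m) ^ p := by positivity
  rw [Real.div_rpow hu0 hσ.le, Real.div_rpow hw0 hσ.le, ← sub_div, abs_div, abs_of_pos hσp,
    div_le_iff₀ hσp] at h1
  refine h1.trans ?_
  gcongr
  rw [Real.rpow_mul hhp.le, Real.rpow_natCast]
  gcongr

/-! ### Polar coordinates adapted to a homogeneous function. -/

theorem lintegral_Ioi_comp_mul_right {c : ℝ} (hc : 0 < c) {H : ℝ → ℝ≥0∞} (hH : Measurable H) :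
    ∫⁻ r in Ioi (0 : ℝ), H (r * c) = ENNReal.ofReal c⁻¹ * ∫⁻ r in Ioi (0 : ℝ), H r := by
  have h1 : ∀ r, (Ioi (0 : ℝ)).indicator (fun r => H (r * c)) r =
      (Ioi (0 : ℝ)).indicator H (r * c) := fun r => by
    simp only [indicator, mem_Ioi, mul_pos_iff_of_pos_right hc]
  rw [← lintegral_indicator measurableSet_Ioi, ← lintegral_indicator measurableSet_Ioi,
    lintegral_congr h1, ← lintegral_map (hH.indicator measurableSet_Ioi) (measurable_mul_const c),
    Real.map_volume_mul_right hc.ne', lintegral_smul_measure, abs_of_pos (inv_pos.2 hc),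
    smul_eq_mul]

theorem lintegral_Ioi_rpow_comp_mul_right {c : ℝ} (hc : 0 < c) (b : ℝ) {q : ℝ → ℝ≥0∞}
    (hq : Measurable q) :
    ∫⁻ r in Ioi (0 : ℝ), ENNReal.ofReal (r ^ b) * q (r * c) =
      ENNReal.ofReal (c ^ (-(b + 1))) * ∫⁻ r in Ioi (0 : ℝ), ENNReal.ofReal (r ^ b) * q r := by
  have hm : Measurable fun r : ℝ => ENNReal.ofReal (r ^ b) * q r := by fun_prop
  have h := lintegral_Ioi_comp_mul_right hc hm
  have h2 : ∫⁻ r in Ioi (0 : ℝ), ENNReal.ofReal ((r * c) ^ b) * q (r * c) =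
      ENNReal.ofReal (c ^ b) * ∫⁻ r in Ioi (0 : ℝ), ENNReal.ofReal (r ^ b) * q (r * c) := by
    rw [← lintegral_const_mul _ (by fun_prop)]
    refine setLIntegral_congr_fun measurableSet_Ioi fun r hr => ?_
    rw [Real.mul_rpow (mem_Ioi.1 hr).le hc.le, ENNReal.ofReal_mul' (by positivity),
      mul_comm (ENNReal.ofReal (r ^ b)), mul_assoc]
  rw [h2] at h
  have h3 : ENNReal.ofReal (c ^ (-b)) * ENNReal.ofReal (c ^ b) = 1 := by
    rw [← ENNReal.ofReal_mul (by positivity), ← Real.rpow_add hc]; simp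
  calc _ = ENNReal.ofReal (c ^ (-b)) * (ENNReal.ofReal (c ^ b) *
        ∫⁻ r in Ioi (0 : ℝ), ENNReal.ofReal (r ^ b) * q (r * c)) := by
        rw [← mul_assoc, h3, one_mul]
    _ = _ := by
        rw [h, ← mul_assoc, ← ENNReal.ofReal_mul (by positivity), neg_add, Real.rpow_add hc,
          Real.rpow_neg_one]

theorem lintegral_Ioo_rpow {b : ℝ} (hb : -1 < b) :
    ∫⁻ r in Ioi (0 : ℝ), ENNReal.ofReal (r ^ b) * (Iio (1 : ℝ)).indicator 1 r =
      ENNReal.ofReal (b + 1)⁻¹ := by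
  have h1 : ∀ r : ℝ, ENNReal.ofReal (r ^ b) * (Iio (1 : ℝ)).indicator 1 r =
      (Iio (1 : ℝ)).indicator (fun r => ENNReal.ofReal (r ^ b)) r := fun r => by
    by_cases hr : r < 1 <;> simp [hr]
  simp only [h1]
  rw [lintegral_indicator measurableSet_Iio, Measure.restrict_restrict measurableSet_Iio,
    Iio_inter_Ioi, Measure.restrict_congr_set Ioo_ae_eq_Ioc,
    ← ofReal_integral_eq_lintegral_ofReal
      ((intervalIntegral.intervalIntegrable_rpow' hb (a := 0) (b := 1)).1),
    ← intervalIntegral.integral_of_le zero_le_one, integral_rpow (Or.inl hb)]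
  · rw [Real.one_rpow, Real.zero_rpow (by linarith)]; simp
  · filter_upwards [ae_restrict_mem measurableSet_Ioc] with r hr
    exact Real.rpow_nonneg hr.1.le _

/-- The Jacobian is a real power so that it can be merged with a homogeneity degree that need not be
an integer. -/
theorem lintegral_eq_lintegral_toSphere (hN : 1 ≤ N) {F : E N → ℝ≥0∞} (hF : Measurable F) :
    ∫⁻ x, F x = ∫⁻ ω, (∫⁻ r in Ioi (0 : ℝ), ENNReal.ofReal (r ^ ((N : ℝ) - 1)) *
      F (r • (ω : E N))) ∂(volume : Measure (E N)).toSphere := by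
  have : Nonempty (Fin N) := ⟨⟨0, hN⟩⟩
  have hcomp := (volume : Measure (E N)).measurePreserving_homeomorphUnitSphereProd
  set G : Metric.sphere (0 : E N) 1 × Ioi (0 : ℝ) → ℝ≥0∞ := fun z => F ((z.2 : ℝ) • (z.1 : E N))
    with hG
  have hGm : Measurable G := by
    refine hF.comp ?_
    exact (measurable_subtype_coe.comp measurable_snd).smul
      (measurable_subtype_coe.comp measurable_fst)
  have h1 : ∫⁻ x, F x = ∫⁻ x : ({(0 : E N)}ᶜ : Set (E N)), F x ∂(volume.comap Subtype.val) := by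
    rw [lintegral_subtype_comap (measurableSet_singleton _).compl, restrict_compl_singleton]
  have h2 : ∀ x : ({(0 : E N)}ᶜ : Set (E N)), F x = G (homeomorphUnitSphereProd (E N) x) := by
    intro x
    have hx : ‖(x : E N)‖ ≠ 0 := norm_ne_zero_iff.2 x.2
    simp [hG, smul_smul, hx]
  rw [h1, lintegral_congr h2, hcomp.lintegral_comp hGm, lintegral_prod _ hGm.aemeasurable]
  refine lintegral_congr fun ω => ?_
  have hGω : Measurable fun r : Ioi (0 : ℝ) => G (ω, r) := hGm.comp (by fun_prop)
  rw [Measure.volumeIoiPow, lintegral_withDensity_eq_lintegral_mul _ (by fun_prop) hGω]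
  rw [← lintegral_subtype_comap measurableSet_Ioi]
  refine lintegral_congr fun r => ?_
  simp only [Pi.mul_apply, hG, finrank_euclideanSpace, Fintype.card_fin]
  rw [← Nat.cast_pred hN, Real.rpow_natCast]

/-- Integration in polar coordinates adapted to a positively homogeneous function `g`, positive off
the origin: a homogeneous density times a function of `g` integrates to a product. -/
theorem lintegral_mul_comp_homogeneous (hN : 1 ≤ N) {g : E N → ℝ} (hg : Continuous g)
    (hgs : ∀ t : ℝ, 0 < t → ∀ x, g (t • x) = t * g x) (hgp : ∀ x, x ≠ 0 → 0 < g x)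
    {a : ℝ} (ha : 0 ≤ a) {Φ : E N → ℝ≥0∞} (hΦ : Measurable Φ)
    (hΦs : ∀ t : ℝ, 0 < t → ∀ x, Φ (t • x) = ENNReal.ofReal (t ^ a) * Φ x)
    {q : ℝ → ℝ≥0∞} (hq : Measurable q) :
    ∫⁻ x, Φ x * q (g x) = ENNReal.ofReal (N + a) * (∫⁻ x in {x | g x < 1}, Φ x) *
      ∫⁻ r in Ioi (0 : ℝ), ENNReal.ofReal (r ^ ((N : ℝ) - 1 + a)) * q r := by
  have hN1 : (1 : ℝ) ≤ N := by exact_mod_cast hN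
  set M := ∫⁻ ω : Metric.sphere (0 : E N) 1, Φ ω * ENNReal.ofReal (g ω ^ (-((N : ℝ) - 1 + a + 1)))
    ∂(volume : Measure (E N)).toSphere with hM
  have key : ∀ {q : ℝ → ℝ≥0∞}, Measurable q → ∫⁻ x, Φ x * q (g x) =
      M * ∫⁻ r in Ioi (0 : ℝ), ENNReal.ofReal (r ^ ((N : ℝ) - 1 + a)) * q r := by
    intro q hq
    rw [lintegral_eq_lintegral_toSphere (F := fun x => Φ x * q (g x)) hN
      (hΦ.mul (hq.comp hg.measurable)), hM,
      ← lintegral_mul_const _ (by fun_prop)]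
    refine lintegral_congr fun ω => ?_
    have hω : (0 : ℝ) < g ω := hgp _ (Metric.ne_of_mem_sphere ω.2 one_ne_zero)
    rw [mul_assoc, ← lintegral_Ioi_rpow_comp_mul_right hω _ hq, ← lintegral_const_mul _ (by fun_prop)]
    refine setLIntegral_congr_fun measurableSet_Ioi fun r hr => ?_
    have hr : 0 < r := hr
    simp only [hΦs r hr, hgs r hr, Real.rpow_add hr]
    rw [ENNReal.ofReal_mul (by positivity)]
    ring
  have hM' : M = ENNReal.ofReal (N + a) * ∫⁻ x in {x | g x < 1}, Φ x := by
    -- The spherical factor `M` does not depend on `q`. The indicator of `r < 1`, whose radial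
    -- integral is `1 / (N + a)`, identifies it, even when it is infinite.
    have h1 := key (q := (Iio (1 : ℝ)).indicator 1) (measurable_one.indicator measurableSet_Iio)
    rw [lintegral_Ioo_rpow (by linarith)] at h1
    have h2 : ∀ x, Φ x * (Iio (1 : ℝ)).indicator 1 (g x) =
        ({x | g x < 1} : Set (E N)).indicator Φ x := fun x => by
      by_cases hx : g x < 1 <;> simp [hx]
    rw [lintegral_congr h2, lintegral_indicator (measurableSet_lt hg.measurable measurable_const)]
      at h1
    rw [h1, mul_comm M, ← mul_assoc, ← ENNReal.ofReal_mul (by linarith),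
      show (N : ℝ) - 1 + a + 1 = N + a by ring, mul_inv_cancel₀ (by linarith), ENNReal.ofReal_one,
      one_mul]
  rw [key hq, hM']

/-- A positively homogeneous function which is positive off the origin is nonsingular. -/
theorem quasiMeasurePreserving_homogeneous (hN : 1 ≤ N) {g : E N → ℝ} (hg : Continuous g)
    (hgs : ∀ t : ℝ, 0 < t → ∀ x, g (t • x) = t * g x) (hgp : ∀ x, x ≠ 0 → 0 < g x) :
    Measure.QuasiMeasurePreserving g volume (volume.restrict (Ioi 0)) := by
  refine ⟨hg.measurable, Measure.AbsolutelyContinuous.mk fun s hs h0 => ?_⟩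
  -- With `q` the indicator of a null set, the radial integral vanishes, hence so does the volume of
  -- the preimage.
  have h := lintegral_mul_comp_homogeneous hN hg hgs hgp le_rfl (Φ := fun _ => 1)
    measurable_const (by simp) (q := s.indicator 1) (measurable_one.indicator hs)
  have hz : ∫⁻ r in Ioi (0 : ℝ), ENNReal.ofReal (r ^ ((N : ℝ) - 1 + 0)) * s.indicator 1 r = 0 := by
    rw [lintegral_eq_zero_iff' (by
      exact (Measurable.mul (by fun_prop) (measurable_one.indicator hs)).aemeasurable)]
    filter_upwards [compl_mem_ae_iff.2 h0] with r hr
    simp [indicator_of_notMem hr]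
  rw [hz, mul_zero] at h
  rw [Measure.map_apply hg.measurable hs, ← lintegral_indicator_one (hg.measurable hs), ← h]
  exact lintegral_congr fun x => by by_cases hx : g x ∈ s <;> simp [hx]

/-- Real-valued form of `lintegral_mul_comp_homogeneous`. -/
theorem integral_div_mul_comp_homogeneous (hN : 1 ≤ N) {g : E N → ℝ} (hg : Continuous g)
    (hgs : ∀ t : ℝ, 0 < t → ∀ x, g (t • x) = t * g x) (hgp : ∀ x, x ≠ 0 → 0 < g x)
    {a : ℝ} (ha : 0 ≤ a) {Φ : E N → ℝ} (hΦ : Measurable Φ) (hΦ0 : ∀ x, 0 ≤ Φ x)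
    (hΦs : ∀ t : ℝ, 0 < t → ∀ x, Φ (t • x) = t ^ a * Φ x)
    (hΦi : IntegrableOn Φ {x | g x < 1} volume)
    {ρ : ℝ → ℝ} (hρ0 : ∀ r ≥ 0, 0 ≤ ρ r)
    (hρi : IntegrableOn (fun r => r ^ (N - 1) * ρ r) (Ioi 0) volume) :
    Integrable (fun x => Φ x / g x ^ a * ρ (g x)) volume ∧
    ∫ x, Φ x / g x ^ a * ρ (g x) =
      (N + a) * (∫ x in {x | g x < 1}, Φ x) * ∫ r in Ioi (0 : ℝ), r ^ (N - 1) * ρ r := by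
  have : Nonempty (Fin N) := ⟨⟨0, hN⟩⟩
  have hne : ∀ᵐ x : E N, x ≠ 0 := Measure.ae_ne volume 0
  have hqmp := quasiMeasurePreserving_homogeneous hN hg hgs hgp
  -- Integrability of `r ^ (N - 1) * ρ r` gives only a.e. measurability of `ρ` on `(0, ∞)`;
  -- nonsingularity of `g` is what carries it to `ρ ∘ g`.
  have hρm : AEMeasurable ρ (volume.restrict (Ioi 0)) := by
    have h1 : AEMeasurable (fun r : ℝ => (r ^ (N - 1))⁻¹ * (r ^ (N - 1) * ρ r))
        (volume.restrict (Ioi 0)) :=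
      AEMeasurable.mul (by fun_prop) hρi.1.aemeasurable
    refine h1.congr ?_
    filter_upwards [ae_restrict_mem measurableSet_Ioi] with r hr
    exact inv_mul_cancel_left₀ (pow_pos (mem_Ioi.1 hr) _).ne' _
  have hmeas : AEStronglyMeasurable (fun x => Φ x / g x ^ a * ρ (g x)) volume :=
    (AEMeasurable.mul (by fun_prop)
      (hρm.comp_quasiMeasurePreserving hqmp)).aestronglyMeasurable
  have hnn : ∀ᵐ x : E N, 0 ≤ Φ x / g x ^ a * ρ (g x) := by
    filter_upwards [hne] with x hx
    have h1 := hgp x hx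
    have h2 := hΦ0 x
    have h3 := hρ0 _ h1.le
    positivity
  have hrnn : ∀ᵐ r ∂volume.restrict (Ioi (0 : ℝ)), 0 ≤ r ^ (N - 1) * ρ r := by
    filter_upwards [ae_restrict_mem measurableSet_Ioi] with r hr
    exact mul_nonneg (pow_nonneg (mem_Ioi.1 hr).le _) (hρ0 _ (mem_Ioi.1 hr).le)
  set q : ℝ → ℝ≥0∞ := fun r => ENNReal.ofReal (hρm.mk ρ r / r ^ a) with hq
  have hqm : Measurable q := by
    have := hρm.measurable_mk
    fun_prop
  have hlin : ∫⁻ x, ENNReal.ofReal (Φ x / g x ^ a * ρ (g x)) =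
      ENNReal.ofReal (N + a) * ENNReal.ofReal (∫ x in {x | g x < 1}, Φ x) *
        ENNReal.ofReal (∫ r in Ioi (0 : ℝ), r ^ (N - 1) * ρ r) := by
    rw [ofReal_integral_eq_lintegral_ofReal hΦi (ae_of_all _ hΦ0),
      ofReal_integral_eq_lintegral_ofReal hρi hrnn]
    have hmain := lintegral_mul_comp_homogeneous hN hg hgs hgp ha hΦ.ennreal_ofReal
      (fun t ht x => by rw [hΦs t ht, ENNReal.ofReal_mul (by positivity)]) hqm
    have hr : ∫⁻ r in Ioi (0 : ℝ), ENNReal.ofReal (r ^ ((N : ℝ) - 1 + a)) * q r =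
        ∫⁻ r in Ioi (0 : ℝ), ENNReal.ofReal (r ^ (N - 1) * ρ r) := by
      refine lintegral_congr_ae ?_
      filter_upwards [ae_restrict_mem measurableSet_Ioi, hρm.ae_eq_mk] with r hr hr'
      have hr : 0 < r := hr
      rw [hq]
      dsimp only
      rw [← hr', ← ENNReal.ofReal_mul (by positivity), Real.rpow_add hr, ← Nat.cast_pred hN,
        Real.rpow_natCast]
      congr 1
      have : r ^ a ≠ 0 := by positivity
      field_simp
    rw [← hr, ← hmain]
    refine lintegral_congr_ae ?_
    filter_upwards [hqmp.ae hρm.ae_eq_mk] with x hx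
    rw [hq]
    dsimp only
    rw [← hx, ← ENNReal.ofReal_mul (hΦ0 x)]
    congr 1
    ring
  refine ⟨⟨hmeas, ?_⟩, ?_⟩
  · rw [hasFiniteIntegral_iff_ofReal hnn, hlin]
    finiteness
  · rw [integral_eq_lintegral_of_nonneg_ae hnn hmeas, hlin, ENNReal.toReal_mul, ENNReal.toReal_mul,
      ENNReal.toReal_ofReal (by positivity),
      ENNReal.toReal_ofReal (integral_nonneg hΦ0),
      ENNReal.toReal_ofReal (integral_nonneg_of_ae hrnn)]

/-! ### The gauge of `K`. -/

section Gauge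

variable {K : Set (E N)}

/-- The origin is the midpoint of an interior point and its reflection. -/
theorem zero_mem_interior_of_symm (hK : Convex ℝ K) (hsymm : ∀ x ∈ K, -x ∈ K)
    (hint : (interior K).Nonempty) : (0 : E N) ∈ interior K := by
  obtain ⟨x, hx⟩ := hint
  have hneg : -K = K := by
    ext y
    exact ⟨fun hy => by simpa using hsymm _ hy, fun hy => hsymm _ hy⟩
  have hx' : -x ∈ interior K := by
    have h := (Homeomorph.neg (E N)).image_interior K
    simp only [Homeomorph.coe_neg, image_neg_eq_neg, hneg] at h
    rw [← h]
    simpa using hx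
  have := hK.interior hx hx' (a := 1 / 2) (b := 1 / 2) (by norm_num) (by norm_num) (by norm_num)
  simpa using this

theorem gauge_pos_of_bounded (hK0 : K ∈ 𝓝 (0 : E N)) (hb : Bornology.IsBounded K) {x : E N}
    (hx : x ≠ 0) : 0 < gauge K x :=
  (gauge_pos (absorbent_nhds_zero hK0) (NormedSpace.isVonNBounded_of_isBounded ℝ hb)).2 hx

theorem exists_norm_le_mul_gauge (hK0 : K ∈ 𝓝 (0 : E N)) (hb : Bornology.IsBounded K) :
    ∃ R > 0, ∀ x : E N, ‖x‖ ≤ R * gauge K x := by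
  obtain ⟨R, hR, hKR⟩ := hb.subset_closedBall_lt 0 0
  refine ⟨R, hR, fun x => ?_⟩
  have h := le_gauge_of_subset_closedBall (absorbent_nhds_zero hK0) hR.le hKR (x := x)
  rwa [div_le_iff₀' hR] at h

/-- The two sets can differ only on the level set `gauge K x = 1`, which is null because the gauge
is nonsingular. -/
theorem gauge_lt_one_ae_eq (hN : 1 ≤ N) (hK : Convex ℝ K) (hK0 : K ∈ 𝓝 (0 : E N))
    (hb : Bornology.IsBounded K) : ({x | gauge K x < 1} : Set (E N)) =ᵐ[volume] K := by
  have hq := quasiMeasurePreserving_homogeneous hN (continuous_gauge hK hK0)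
    (fun t ht x => gauge_smul_of_nonneg ht.le x) (fun x hx => gauge_pos_of_bounded hK0 hb hx)
  have h1 : ∀ᵐ r ∂volume.restrict (Ioi (0 : ℝ)), r ≠ 1 :=
    ae_restrict_of_ae (Measure.ae_ne volume 1)
  filter_upwards [hq.ae h1] with x hx
  refine propext ⟨fun h => ?_, fun h => ?_⟩
  · exact setOfPred_gauge_lt_one_subset_self hK (mem_of_mem_nhds hK0) (absorbent_nhds_zero hK0) h
  · exact lt_of_le_of_ne (gauge_le_one_of_mem h) hx

end Gauge

/-! ### Measurability and integrability of differences and differentials. -/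

section Measurability

theorem MemSobolev.aestronglyMeasurable_finiteDiff {m : ℕ} {p : ℝ} {f : E N → ℝ}
    (hf : MemSobolev m p f) (hm : 1 ≤ m) :
    AEStronglyMeasurable (fun z : E N × E N => finiteDiff m f z.2 (z.2 + z.1))
      (volume.prod volume) := by
  have h0 : (m : ℝ) ≠ 0 := by positivity
  unfold finiteDiff
  refine Finset.aestronglyMeasurable_fun_sum _ fun j _ => AEStronglyMeasurable.const_mul ?_ _
  have h1 : ∀ z : E N × E N, (((m : ℝ) - j) / m) • z.2 + ((j : ℝ) / m) • (z.2 + z.1) =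
      z.2 + ((j : ℝ) / m) • z.1 := fun z => by
    rw [smul_add, ← add_assoc, ← add_smul, ← add_div, sub_add_cancel, div_self h0, one_smul]
  simp only [h1]
  exact hf.1.1.comp_quasiMeasurePreserving
    (quasiMeasurePreserving_shear_snd volume (L := fun h : E N => ((j : ℝ) / m) • h) (by fun_prop))

theorem MemSobolev.aestronglyMeasurable_weakDiff {m : ℕ} {p : ℝ} {f : E N → ℝ}
    (hf : MemSobolev m p f) (ν : Measure (E N)) [SFinite ν] :
    AEStronglyMeasurable (fun z : E N × E N => weakDiff m f z.1 z.2) (volume.prod ν) := by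
  unfold weakDiff
  refine Finset.aestronglyMeasurable_fun_sum _ fun I _ => AEStronglyMeasurable.mul ?_ ?_
  · exact Continuous.aestronglyMeasurable (by fun_prop)
  · exact (hf.memLp_weakPartialDeriv le_rfl I).1.comp_fst

/-- The polar formula needs a truly measurable density. The finitely many weak derivatives are
replaced by measurable representatives off a null set independent of `h`. -/
theorem MemSobolev.measurable_integral_weakDiff {m : ℕ} {p : ℝ} {f : E N → ℝ}
    (hf : MemSobolev m p f) : Measurable fun h : E N => ∫ x, |weakDiff m f x h| ^ p := by
  have hI : ∀ I : Fin m → Fin N, AEStronglyMeasurable (weakPartialDeriv I f) volume :=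
    fun I => (hf.memLp_weakPartialDeriv le_rfl I).1
  have h1 : ∀ h : E N, ∫ x, |weakDiff m f x h| ^ p =
      ∫ x, |∑ I : Fin m → Fin N, (∏ j, h (I j)) * (hI I).mk _ x| ^ p := fun h => by
    refine integral_congr_ae ?_
    filter_upwards [ae_all_iff.2 fun I => (hI I).ae_eq_mk] with x hx
    simp only [weakDiff, hx]
  simp only [h1]
  have h2 : Measurable fun z : E N × E N =>
      |∑ I : Fin m → Fin N, (∏ j, z.1 (I j)) * (hI I).mk _ z.2| ^ p := by
    refine Measurable.pow_const (Measurable.abs ?_) p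
    refine Finset.measurable_sum _ fun I _ => Measurable.mul ?_ ?_
    · exact Continuous.measurable (by fun_prop)
    · exact (hI I).stronglyMeasurable_mk.measurable.comp measurable_snd
  exact h2.stronglyMeasurable.integral_prod_right.measurable

theorem integrable_abs_rpow {p : ℝ} (hp : 0 < p) {u : E N → ℝ}
    (hu : MemLp u (ENNReal.ofReal p) volume) : Integrable (fun x => |u x| ^ p) volume := by
  have h := hu.integrable_norm_rpow (by simpa using hp) ENNReal.ofReal_ne_top
  rwa [ENNReal.toReal_ofReal hp.le] at h

theorem integral_weakDiff_smul {m : ℕ} {p : ℝ} (f : E N → ℝ) {t : ℝ} (ht : 0 < t) (h : E N) :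
    ∫ x, |weakDiff m f x (t • h)| ^ p = t ^ (m * p) * ∫ x, |weakDiff m f x h| ^ p := by
  simp only [weakDiff_smul, abs_mul, Real.mul_rpow (abs_nonneg _) (abs_nonneg _),
    integral_const_mul]
  rw [abs_of_pos (pow_pos ht m), ← Real.rpow_natCast, ← Real.rpow_mul ht.le]

theorem MemSobolev.integrable_weakDiff {m : ℕ} (hm : 1 ≤ m) {p : ℝ} (hp : 1 < p) {f : E N → ℝ}
    (hf : MemSobolev m p f) {K : Set (E N)} (hK : Bornology.IsBounded K) :
    Integrable (fun z : E N × E N => |weakDiff m f z.1 z.2| ^ p)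
      (volume.prod (volume.restrict K)) := by
  have hp0 : 0 < p := by linarith
  have hm0 : (0 : ℝ) ≤ m := by positivity
  have hmeas : AEStronglyMeasurable (fun z : E N × E N => |weakDiff m f z.1 z.2| ^ p)
      (volume.prod (volume.restrict K)) :=
    ((hf.aestronglyMeasurable_weakDiff _).norm.aemeasurable.pow_const p).aestronglyMeasurable
  refine (integrable_prod_iff' hmeas).2
    ⟨ae_of_all _ fun y => integrable_abs_rpow hp0 (hf.memLp_weakDiff y), ?_⟩
  obtain ⟨B, hB, H⟩ := hf.exists_bound_integral hm hp
  obtain ⟨R, hR, hKR⟩ := hK.subset_closedBall_lt 0 0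
  have hnorm : ∀ y, ∫ x, ‖|weakDiff m f x y| ^ p‖ = ∫ x, |weakDiff m f x y| ^ p := fun y =>
    integral_congr_ae (ae_of_all _ fun x => Real.norm_of_nonneg (by positivity))
  simp only [hnorm]
  have hball : IntegrableOn (fun y => ∫ x, |weakDiff m f x y| ^ p) (Metric.closedBall 0 R)
      volume := by
    refine Measure.integrableOn_of_bounded (M := B * R ^ (m * p)) measure_closedBall_lt_top.ne
      hf.measurable_integral_weakDiff.aestronglyMeasurable ?_
    filter_upwards [ae_restrict_mem Metric.isClosed_closedBall.measurableSet] with y hy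
    rw [Real.norm_of_nonneg (integral_nonneg fun x => by positivity)]
    refine (H y).2.trans ?_
    have : ‖y‖ ≤ R := by simpa using hy
    gcongr
  exact hball.mono_set hKR

end Measurability

/-- The change of variables `(h, x) ↦ (x, x + h)`. -/
def pairOfIncrement (N : ℕ) : E N × E N ≃ᵐ E N × E N :=
  MeasurableEquiv.prodComm.trans (MeasurableEquiv.shearAddRight (E N))

theorem pairOfIncrement_apply (z : E N × E N) : pairOfIncrement N z = (z.2, z.2 + z.1) := rfl

theorem measurePreserving_pairOfIncrement (N : ℕ) :
    MeasurePreserving (pairOfIncrement N) (volume.prod volume) (volume.prod volume) :=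
  (measurePreserving_prod_add volume volume).comp Measure.measurePreserving_swap

/-! ### The energy as an integral over increments. -/

section Main

variable {m : ℕ} {p : ℝ} {K : Set (E N)} {f : E N → ℝ} {ρ : ℝ → ℝ}

theorem bbmIntegrand_add (hsymm : ∀ x ∈ K, -x ∈ K) (m : ℕ) (p : ℝ) (ρ : ℝ → ℝ) (f : E N → ℝ)
    (x h : E N) : bbmIntegrand K m p ρ f x (x + h) =
      (gauge K h ^ ((m : ℝ) * p))⁻¹ * ρ (gauge K h) * |finiteDiff m f x (x + h)| ^ p := by
  rw [bbmIntegrand, sub_add_cancel_left, gauge_neg hsymm]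
  ring

/-- The polar formula with degree `0` and density `1`; it is used to integrate error bounds
proportional to `ρ (gauge K h)`. -/
theorem integrable_gauge_density (hN : 1 ≤ N) (hK : Convex ℝ K) (hK0 : K ∈ 𝓝 (0 : E N))
    (hb : Bornology.IsBounded K) (hρ0 : ∀ r ≥ 0, 0 ≤ ρ r)
    (hρi : IntegrableOn (fun r => r ^ (N - 1) * ρ r) (Ioi 0) volume) :
    Integrable (fun x : E N => ρ (gauge K x)) volume ∧
    ∫ x : E N, ρ (gauge K x) = N * volume.real K * ∫ r in Ioi (0 : ℝ), r ^ (N - 1) * ρ r := by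
  have hae := gauge_lt_one_ae_eq hN hK hK0 hb
  have hfin : volume ({x | gauge K x < 1} : Set (E N)) ≠ ∞ := by
    rw [measure_congr hae]; exact hb.measure_lt_top.ne
  have h := integral_div_mul_comp_homogeneous hN (continuous_gauge hK hK0)
    (fun t ht x => gauge_smul_of_nonneg ht.le x) (fun x hx => gauge_pos_of_bounded hK0 hb hx)
    le_rfl (Φ := fun _ => 1) measurable_const (fun _ => zero_le_one) (by simp)
    (integrableOn_const hfin) hρ0 hρi
  simpa [measureReal_congr hae] using h

/-- By Tonelli it suffices to integrate in `x` first: that integral is at most `B ‖h‖^{mp}`, and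
`‖h‖ ≤ R * gauge K h` cancels the singular weight. -/
theorem MemSobolev.integrable_increment_energy (hf : MemSobolev m p f) (hm : 1 ≤ m) (hp : 1 < p)
    (hN : 1 ≤ N) (hK : Convex ℝ K) (hK0 : K ∈ 𝓝 (0 : E N)) (hb : Bornology.IsBounded K)
    (hρ0 : ∀ r ≥ 0, 0 ≤ ρ r) (hρi : IntegrableOn (fun r => r ^ (N - 1) * ρ r) (Ioi 0) volume) :
    Integrable (fun z : E N × E N => (gauge K z.1 ^ ((m : ℝ) * p))⁻¹ * ρ (gauge K z.1) *
      |finiteDiff m f z.2 (z.2 + z.1)| ^ p) (volume.prod volume) := by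
  have hp0 : 0 < p := by linarith
  have hρK := (integrable_gauge_density hN hK hK0 hb hρ0 hρi).1
  have hcont := continuous_gauge hK hK0
  have hmeas : AEStronglyMeasurable (fun z : E N × E N => (gauge K z.1 ^ ((m : ℝ) * p))⁻¹ *
      ρ (gauge K z.1) * |finiteDiff m f z.2 (z.2 + z.1)| ^ p) (volume.prod volume) := by
    refine AEStronglyMeasurable.mul (AEStronglyMeasurable.mul ?_ hρK.1.comp_fst) ?_
    · exact Measurable.aestronglyMeasurable (by fun_prop)
    · exact ((hf.aestronglyMeasurable_finiteDiff hm).norm.aemeasurable.pow_const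
        p).aestronglyMeasurable
  refine (integrable_prod_iff hmeas).2 ⟨ae_of_all _ fun h =>
    (integrable_abs_rpow hp0 (hf.memLp_finiteDiff hm h)).const_mul
      ((gauge K h ^ ((m : ℝ) * p))⁻¹ * ρ (gauge K h)), ?_⟩
  obtain ⟨B, hB, H⟩ := hf.exists_bound_integral hm hp
  obtain ⟨R, hR, hRg⟩ := exists_norm_le_mul_gauge hK0 hb
  refine (hρK.const_mul (B * R ^ ((m : ℝ) * p))).mono' hmeas.norm.integral_prod_right' ?_
  have : Nonempty (Fin N) := ⟨⟨0, hN⟩⟩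
  filter_upwards [Measure.ae_ne volume (0 : E N)] with h hh
  have hg := gauge_pos_of_bounded hK0 hb hh
  have hρ := hρ0 _ hg.le
  rw [Real.norm_of_nonneg (integral_nonneg fun _ => norm_nonneg _)]
  have h1 : ∀ x, ‖(gauge K h ^ ((m : ℝ) * p))⁻¹ * ρ (gauge K h) *
      |finiteDiff m f x (x + h)| ^ p‖ = (gauge K h ^ ((m : ℝ) * p))⁻¹ * ρ (gauge K h) *
      |finiteDiff m f x (x + h)| ^ p := fun x => Real.norm_of_nonneg (by positivity)
  simp only [h1, integral_const_mul]
  have h2 : ‖h‖ ^ ((m : ℝ) * p) ≤ R ^ ((m : ℝ) * p) * gauge K h ^ ((m : ℝ) * p) := by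
    rw [← Real.mul_rpow hR.le hg.le]
    exact Real.rpow_le_rpow (norm_nonneg _) (hRg h) (by positivity)
  have hgp : 0 < gauge K h ^ ((m : ℝ) * p) := by positivity
  calc _ ≤ (gauge K h ^ ((m : ℝ) * p))⁻¹ * ρ (gauge K h) *
        (B * (R ^ ((m : ℝ) * p) * gauge K h ^ ((m : ℝ) * p))) := by
        gcongr
        exact (H h).1.trans (by gcongr)
    _ = _ := by field_simp

theorem MemSobolev.integrable_bbmIntegrand (hf : MemSobolev m p f) (hm : 1 ≤ m) (hp : 1 < p)
    (hN : 1 ≤ N) (hK : Convex ℝ K) (hsymm : ∀ x ∈ K, -x ∈ K) (hK0 : K ∈ 𝓝 (0 : E N))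
    (hb : Bornology.IsBounded K) (hρ0 : ∀ r ≥ 0, 0 ≤ ρ r)
    (hρi : IntegrableOn (fun r => r ^ (N - 1) * ρ r) (Ioi 0) volume) :
    Integrable (fun z : E N × E N => bbmIntegrand K m p ρ f z.1 z.2) (volume.prod volume) := by
  rw [← (measurePreserving_pairOfIncrement N).integrable_comp_emb
    (pairOfIncrement N).measurableEmbedding]
  simpa only [Function.comp_def, pairOfIncrement_apply, bbmIntegrand_add hsymm] using
    hf.integrable_increment_energy hm hp hN hK hK0 hb hρ0 hρi

theorem MemSobolev.integral_bbmIntegrand_eq (hf : MemSobolev m p f) (hm : 1 ≤ m) (hp : 1 < p)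
    (hN : 1 ≤ N) (hK : Convex ℝ K) (hsymm : ∀ x ∈ K, -x ∈ K) (hK0 : K ∈ 𝓝 (0 : E N))
    (hb : Bornology.IsBounded K) (hρ0 : ∀ r ≥ 0, 0 ≤ ρ r)
    (hρi : IntegrableOn (fun r => r ^ (N - 1) * ρ r) (Ioi 0) volume) :
    Integrable (fun h : E N => (∫ x, |finiteDiff m f x (x + h)| ^ p) /
      gauge K h ^ ((m : ℝ) * p) * ρ (gauge K h)) volume ∧
    ∫ y, ∫ x, bbmIntegrand K m p ρ f x y =
      ∫ h : E N, (∫ x, |finiteDiff m f x (x + h)| ^ p) / gauge K h ^ ((m : ℝ) * p) *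
        ρ (gauge K h) := by
  have hint := hf.integrable_increment_energy hm hp hN hK hK0 hb hρ0 hρi
  have heq : ∀ h : E N, ∫ x, (gauge K h ^ ((m : ℝ) * p))⁻¹ * ρ (gauge K h) *
      |finiteDiff m f x (x + h)| ^ p = (∫ x, |finiteDiff m f x (x + h)| ^ p) /
        gauge K h ^ ((m : ℝ) * p) * ρ (gauge K h) := fun h => by
    rw [integral_const_mul]; ring
  constructor
  · have h := hint.integral_prod_left
    simpa only [heq] using h
  · rw [← integral_prod_symm _ (hf.integrable_bbmIntegrand hm hp hN hK hsymm hK0 hb hρ0 hρi),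
      ← (measurePreserving_pairOfIncrement N).integral_comp
        (pairOfIncrement N).measurableEmbedding]
    simp only [pairOfIncrement_apply, bbmIntegrand_add hsymm]
    rw [integral_prod _ hint]
    simp only [heq]

/-- The polar formula applied to the density `W`, homogeneous of degree `mp`: the local energy sees
the kernel only through its total mass. -/
theorem MemSobolev.integral_weakDiff_div_gauge (hf : MemSobolev m p f) (hm : 1 ≤ m) (hp : 1 < p)
    (hN : 1 ≤ N) (hK : Convex ℝ K) (hK0 : K ∈ 𝓝 (0 : E N))
    (hb : Bornology.IsBounded K) (hρ0 : ∀ r ≥ 0, 0 ≤ ρ r)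
    (hρi : IntegrableOn (fun r => r ^ (N - 1) * ρ r) (Ioi 0) volume) :
    Integrable (fun h : E N => (∫ x, |weakDiff m f x h| ^ p) /
      gauge K h ^ ((m : ℝ) * p) * ρ (gauge K h)) volume ∧
    ∫ h : E N, (∫ x, |weakDiff m f x h| ^ p) / gauge K h ^ ((m : ℝ) * p) * ρ (gauge K h) =
      (N + m * p) * (∫ x, ∫ y in K, |weakDiff m f x y| ^ p) *
        ∫ r in Ioi (0 : ℝ), r ^ (N - 1) * ρ r := by
  have hae := gauge_lt_one_ae_eq hN hK hK0 hb
  have hI := hf.integrable_weakDiff hm hp hb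
  have hIK : IntegrableOn (fun y => ∫ x, |weakDiff m f x y| ^ p) {y | gauge K y < 1} volume := by
    rw [IntegrableOn, Measure.restrict_congr_set hae]
    exact hI.integral_prod_right
  have h := integral_div_mul_comp_homogeneous hN (continuous_gauge hK hK0)
    (fun t ht x => gauge_smul_of_nonneg ht.le x) (fun x hx => gauge_pos_of_bounded hK0 hb hx)
    (a := m * p) (by positivity) hf.measurable_integral_weakDiff
    (fun y => integral_nonneg fun x => by positivity)
    (fun t ht y => integral_weakDiff_smul f ht y) hIK hρ0 hρi
  rw [Measure.restrict_congr_set hae] at h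
  rw [integral_integral_swap (f := fun x y => |weakDiff m f x y| ^ p) hI]
  exact h

end Main

/-- Quantitative comparison of the nonlocal energy with its local limit: the error is small up to
the mass which the kernel carries away from the origin. -/
theorem MemSobolev.exists_abs_energy_sub_le {N m : ℕ} {p : ℝ} {K : Set (E N)} {f : E N → ℝ}
    (hf : MemSobolev m p f) (hm : 1 ≤ m) (hp : 1 < p)
    (hN : 1 ≤ N) (hK : Convex ℝ K) (hsymm : ∀ x ∈ K, -x ∈ K) (hK0 : K ∈ 𝓝 (0 : E N))
    (hb : Bornology.IsBounded K) :
    ∃ C : ℝ, ∀ η > 0, ∃ δ > 0, ∀ ρ : ℝ → ℝ, (∀ r ≥ 0, 0 ≤ ρ r) →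
      IntegrableOn (fun r => r ^ (N - 1) * ρ r) (Ioi 0) volume →
      ∫ r in Ioi (0 : ℝ), r ^ (N - 1) * ρ r = 1 →
      |(∫ y, ∫ x, bbmIntegrand K m p ρ f x y) - ((N : ℝ) + m * p) / (m : ℝ) ^ ((m : ℝ) * p) *
        ∫ x, ∫ y in K, |weakDiff m f x y| ^ p| ≤
        η + C * ∫ r in Ioi δ, r ^ (N - 1) * ρ r := by
  obtain ⟨B, hB, H⟩ := hf.exists_bound_integral hm hp
  obtain ⟨R, hR, hRg⟩ := exists_norm_le_mul_gauge hK0 hb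
  set a : ℝ := m * p with ha
  have ha0 : 0 ≤ a := by positivity
  have hma : 1 ≤ (m : ℝ) ^ a := Real.one_le_rpow (by exact_mod_cast hm) ha0
  set V : ℝ := N * volume.real K with hV
  have hV0 : 0 ≤ V := by positivity
  -- Far from the origin the integrand is at most `2 * B * R ^ a * ρ (gauge K h)`, and `V` is the
  -- factor in the integral of a gauge density.
  refine ⟨2 * B * R ^ a * V, fun η hη => ?_⟩
  have hRa : 0 < R ^ a := by positivity
  -- `R ^ a` pays for replacing `‖h‖` by the gauge and `V + 1` for the integration in `h`; adding
  -- `1` avoids a zero denominator.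
  obtain ⟨δ, hδ, hclose⟩ := hf.exists_abs_integral_sub_le hm hp
    (η := η / (R ^ a * (V + 1))) (by positivity)
  refine ⟨δ / (2 * R), by positivity, fun ρ hρ0 hρi hρ1 => ?_⟩
  set δ' := δ / (2 * R) with hδ'
  have hδ'0 : 0 < δ' := by positivity
  -- The truncated kernel has as its mass the tail of `ρ`, so the same density formula handles the
  -- far region.
  set ρ' : ℝ → ℝ := (Ioi δ').indicator ρ with hρ'
  have hρ'0 : ∀ r ≥ 0, 0 ≤ ρ' r := fun r hr => indicator_apply_nonneg fun _ => hρ0 r hr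
  have hind : (fun r : ℝ => r ^ (N - 1) * ρ' r) =
      (Ioi δ').indicator (fun r => r ^ (N - 1) * ρ r) := by
    ext r; by_cases hr : r ∈ Ioi δ' <;> simp [hρ', hr]
  have hρ'i : IntegrableOn (fun r => r ^ (N - 1) * ρ' r) (Ioi 0) volume := by
    rw [hind]; exact hρi.indicator measurableSet_Ioi
  have hρ'1 : ∫ r in Ioi (0 : ℝ), r ^ (N - 1) * ρ' r = ∫ r in Ioi δ', r ^ (N - 1) * ρ r := by
    rw [hind, setIntegral_indicator measurableSet_Ioi,
      inter_eq_self_of_subset_right (Ioi_subset_Ioi hδ'0.le)]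
  obtain ⟨hI1, hE1⟩ := integrable_gauge_density hN hK hK0 hb hρ0 hρi
  obtain ⟨hI2, hE2⟩ := integrable_gauge_density hN hK hK0 hb hρ'0 hρ'i
  obtain ⟨hI3, hE3⟩ := hf.integral_bbmIntegrand_eq hm hp hN hK hsymm hK0 hb hρ0 hρi
  obtain ⟨hI4, hE4⟩ := hf.integral_weakDiff_div_gauge hm hp hN hK hK0 hb hρ0 hρi
  rw [hρ1, mul_one] at hE1 hE4
  rw [hρ'1] at hE2
  rw [hE3, div_mul_eq_mul_div, ← hE4, ← integral_div, ← integral_sub hI3 (hI4.div_const _)]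
  refine (abs_integral_le_integral_abs).trans ?_
  have hpt : ∀ᵐ h : E N, |(∫ x, |finiteDiff m f x (x + h)| ^ p) / gauge K h ^ a *
      ρ (gauge K h) - (∫ x, |weakDiff m f x h| ^ p) / gauge K h ^ a * ρ (gauge K h) / m ^ a| ≤
      η / (V + 1) * ρ (gauge K h) + 2 * B * R ^ a * ρ' (gauge K h) := by
    have : Nonempty (Fin N) := ⟨⟨0, hN⟩⟩
    filter_upwards [Measure.ae_ne volume (0 : E N)] with h hh
    have hg := gauge_pos_of_bounded hK0 hb hh
    have hga : 0 < gauge K h ^ a := by positivity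
    have hρ := hρ0 _ hg.le
    have hhR : ‖h‖ ^ a ≤ R ^ a * gauge K h ^ a := by
      rw [← Real.mul_rpow hR.le hg.le]
      exact Real.rpow_le_rpow (norm_nonneg _) (hRg h) ha0
    set A := ∫ x, |finiteDiff m f x (x + h)| ^ p with hA
    set W := ∫ x, |weakDiff m f x h| ^ p with hW
    have hfac : A / gauge K h ^ a * ρ (gauge K h) - W / gauge K h ^ a * ρ (gauge K h) / m ^ a =
        (A - W / m ^ a) * (ρ (gauge K h) / gauge K h ^ a) := by ring
    rw [hfac, abs_mul, abs_of_nonneg (by positivity : 0 ≤ ρ (gauge K h) / gauge K h ^ a)]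
    by_cases hfar : gauge K h ∈ Ioi δ'
    · have hA0 : 0 ≤ A := integral_nonneg fun x => by positivity
      have hW0 : 0 ≤ W := integral_nonneg fun x => by positivity
      have hW1 : W / m ^ a ≤ W := div_le_self hW0 hma
      have hW2 : 0 ≤ W / m ^ a := by positivity
      have hBh : B * ‖h‖ ^ a ≤ B * (R ^ a * gauge K h ^ a) := by gcongr
      have h1 : |A - W / m ^ a| ≤ 2 * (B * (R ^ a * gauge K h ^ a)) := by
        rw [abs_le]
        constructor <;> linarith [(H h).1, (H h).2]
      rw [hρ', indicator_of_mem hfar]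
      calc _ ≤ 2 * (B * (R ^ a * gauge K h ^ a)) * (ρ (gauge K h) / gauge K h ^ a) := by gcongr
        _ = 2 * B * R ^ a * ρ (gauge K h) := by field_simp
        _ ≤ _ := le_add_of_nonneg_left (by positivity)
    · have hle : gauge K h ≤ δ' := not_lt.1 hfar
      have hhδ : ‖h‖ < δ := by
        calc ‖h‖ ≤ R * gauge K h := hRg h
          _ ≤ R * δ' := by gcongr
          _ = δ / 2 := by rw [hδ']; field_simp
          _ < δ := half_lt_self hδ
      have h1 := (hclose h hh hhδ).trans
        (mul_le_mul_of_nonneg_left hhR (by positivity))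
      rw [hρ', indicator_of_notMem hfar, mul_zero, add_zero]
      calc _ ≤ η / (R ^ a * (V + 1)) * (R ^ a * gauge K h ^ a) *
            (ρ (gauge K h) / gauge K h ^ a) := by gcongr
        _ = _ := by field_simp
  calc _ ≤ ∫ h : E N, (η / (V + 1) * ρ (gauge K h) + 2 * B * R ^ a * ρ' (gauge K h)) :=
        integral_mono_ae (hI3.sub (hI4.div_const _)).abs
          ((hI1.const_mul _).add (hI2.const_mul _)) hpt
    _ = η / (V + 1) * V + 2 * B * R ^ a * V * ∫ r in Ioi δ', r ^ (N - 1) * ρ r := by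
        rw [integral_add (hI1.const_mul _) (hI2.const_mul _), integral_const_mul,
          integral_const_mul, hE1, hE2]
        ring
    _ ≤ _ := by
        gcongr
        rw [div_mul_eq_mul_div, div_le_iff₀ (by positivity)]
        nlinarith

end HighOrderBBM

/-- Since each `ρ ε` satisfies `∫ r in Ioi 0, r ^ (N - 1) * ρ ε r = 1 ≠ 0`, the function
`r ^ (N - 1) * ρ ε r` is automatically measurable (a.e.) and integrable on `(0, ∞)`. -/
theorem theorem1p2 (N m : ℕ) (hN : 1 ≤ N) (hm : 1 ≤ m) (p : ℝ) (hp : 1 < p)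
    (K : Set (HighOrderBBM.E N)) (hKconv : Convex ℝ K) (hKsymm : ∀ x ∈ K, -x ∈ K)
    (hK0 : (0 : HighOrderBBM.E N) ∈ K) (hKint : (interior K).Nonempty)
    (hKbdd : Bornology.IsBounded K)
    (ρ : ℝ → ℝ → ℝ) (hρ0 : ∀ ε > 0, ∀ r ≥ 0, 0 ≤ ρ ε r)
    (hρ1 : ∀ ε > 0, ∫ r in Ioi (0 : ℝ), r ^ (N - 1) * ρ ε r = 1)
    (hρlim : ∀ δ > 0,
      Tendsto (fun ε => ∫ r in Ioi δ, r ^ (N - 1) * ρ ε r) (𝓝[>] (0 : ℝ)) (𝓝 0))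
    (f : HighOrderBBM.E N → ℝ) (hf : HighOrderBBM.MemSobolev m p f) :
    (∀ ε > 0, Integrable
      (fun z : HighOrderBBM.E N × HighOrderBBM.E N =>
        HighOrderBBM.bbmIntegrand K m p (ρ ε) f z.1 z.2) (volume.prod volume)) ∧
    Integrable
      (fun z : HighOrderBBM.E N × HighOrderBBM.E N => |HighOrderBBM.weakDiff m f z.1 z.2| ^ p)
      (volume.prod (volume.restrict K)) ∧
    Tendsto (fun ε => ∫ y, ∫ x, HighOrderBBM.bbmIntegrand K m p (ρ ε) f x y) (𝓝[>] (0 : ℝ))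
      (𝓝 (((N : ℝ) + (m : ℝ) * p) / (m : ℝ) ^ ((m : ℝ) * p) *
        ∫ x, ∫ y in K, |HighOrderBBM.weakDiff m f x y| ^ p)) := by
  have hKnhds : K ∈ 𝓝 (0 : HighOrderBBM.E N) :=
    mem_interior_iff_mem_nhds.1 (HighOrderBBM.zero_mem_interior_of_symm hKconv hKsymm hKint)
  -- A non-integrable function has Bochner integral `0`, which differs from `1`.
  have hρi : ∀ ε > 0, IntegrableOn (fun r => r ^ (N - 1) * ρ ε r) (Ioi 0) volume :=
    fun ε hε => not_imp_comm.1 integral_undef (by rw [hρ1 ε hε]; exact one_ne_zero)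
  refine ⟨fun ε hε => hf.integrable_bbmIntegrand hm hp hN hKconv hKsymm hKnhds hKbdd (hρ0 ε hε)
    (hρi ε hε), hf.integrable_weakDiff hm hp hKbdd, ?_⟩
  obtain ⟨C, hC⟩ := hf.exists_abs_energy_sub_le hm hp hN hKconv hKsymm hKnhds hKbdd
  rw [Metric.tendsto_nhds]
  intro η hη
  obtain ⟨δ, hδ, hest⟩ := hC (η / 2) (half_pos hη)
  have htail : Tendsto (fun ε => C * ∫ r in Ioi δ, r ^ (N - 1) * ρ ε r) (𝓝[>] 0) (𝓝 0) := by
    simpa using (hρlim δ hδ).const_mul C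
  filter_upwards [htail.eventually_lt_const (half_pos hη), self_mem_nhdsWithin] with ε hε hε0
  rw [Real.dist_eq]
  linarith [hest (ρ ε) (hρ0 ε hε0) (hρi ε hε0) (hρ1 ε hε0)]
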